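/- Let $N\ge 0$ and let $z=(z_1,\dots,z_{N+3})$ be distinct points of $\mathbb C$. A \emph{triangulation} $T$ of these points is a set $\mathcal F(T)$ of nondegenerate triangles (faces) whose vertices are among the points, such that two faces always meet exactly in the convex hull of their common vertices, the faces cover the convex hull of $\{z_1,\dots,z_{N+3}\}$, and each $z_v$ is a vertex of some face; all faces are given the positive (counterclockwise) orientation. It is a \emph{Delaunay triangulation} if no point $z_v$ lies in the open disc bounded by the circumcircle of a face. For a triangle $f$ in $\mathbb C$ let $\mathbf V(f)>0$ be the hyperbolic volume of the ideal tetrahedron in the upper half-space $\mathbb H^3=\{(w,h):w\in\mathbb C,\ h>0\}$ with metric $(dw\,d\bar w+dh^2)/h^2$ whose ideal vertices are $\infty$ and the three vertices of $f$. For a triangulation $T$ put $\mathcal A_T=-\sum_{f\in\mathcal F(T)}\mathbf V(f)$, regarded (with the combinatorics of $T$ fixed) as a function of the positions of the vertices, and let $$D_{u\bar v}(T)=\frac{\partial}{\partial z_u}\frac{\partial}{\partial\bar z_v}\mathcal A_T,\qquad 1\le u,v\le N+3,$$ evaluated at $z$. For distinct $i,j,k\in\{1,\dots,N+3\}$ let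 $$d_{(ijk)}(T)=\det\big[D_{u\bar v}(T)\big]_{u,v\notin\{i,j,k\}}.$$ Then for every Delaunay triangulation $T^D$ of the points and all distinct $i,j,k$, $$d_{(ijk)}(T^D)=\max_{T}\,d_{(ijk)}(T),$$ where $T$ ranges over all triangulations of $\{z_1,\dots,z_{N+3}\}$ (in particular these complex numbers are compared through real, nonnegative differences). -/

import Mathlib

open MeasureTheory

noncomputable section

/-- A triangulation of the finite planar point configuration `z : ι → ℂ`, recorded by its set of
bounded faces. Each face is a set of three (indices of) points forming a nondegenerate triangle,
two faces meet exactly in the convex hull of their common vertices, the faces fill the convex hull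
of the configuration, and every point is a vertex. (These conditions force `z` to be injective and
forbid a point in a face of which it is not a vertex.) -/
structure PointTriangulation {ι : Type*} (z : ι → ℂ) where
  faces : Finset (Finset ι)
  card_face : ∀ f ∈ faces, f.card = 3
  affineIndependent_face : ∀ f ∈ faces, AffineIndependent ℝ (fun v : f => z v)
  inter_face : ∀ f ∈ faces, ∀ g ∈ faces,
    convexHull ℝ (z '' (f : Set ι)) ∩ convexHull ℝ (z '' (g : Set ι)) =
      convexHull ℝ (z '' ((f : Set ι) ∩ (g : Set ι)))
  iUnion_face : ⋃ f ∈ faces, convexHull ℝ (z '' (f : Set ι)) = convexHull ℝ (Set.range z)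
  exists_face : ∀ v, ∃ f ∈ faces, v ∈ f

/-- A triangulation is Delaunay when the open disc bounded by the circumcircle of any face contains
no point of the configuration. -/
def PointTriangulation.IsDelaunay {ι : Type*} {z : ι → ℂ} (T : PointTriangulation z) : Prop :=
  ∀ f ∈ T.faces, ∀ (c : ℂ) (R : ℝ), (∀ v ∈ f, dist (z v) c = R) → ∀ w, R ≤ dist (z w) c

/-- The volume measure of the upper half-space `{(w, h) : w ∈ ℂ, h > 0}` for the Poincaré metric
`(dw dw̄ + dh²) / h²`, that is `dx dy dh / h³`. -/
def hyperbolicVolume : Measure (ℂ × ℝ) :=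
  (volume.restrict {p : ℂ × ℝ | 0 < p.2}).withDensity
    (fun p => ENNReal.ofReal (1 / p.2 ^ 3))

/-- The ideal tetrahedron in the upper half-space with ideal vertices `∞` and the three points of
`s ⊆ ℂ`: the part of the vertical prism over the Euclidean triangle spanned by `s` that lies on or
above the hemisphere centred on `ℂ` through the points of `s`. -/
def idealTetrahedron (s : Set ℂ) : Set (ℂ × ℝ) :=
  {p | p.1 ∈ convexHull ℝ s ∧ 0 < p.2 ∧
    ∀ (c : ℂ) (R : ℝ), (∀ a ∈ s, dist a c = R) → R ^ 2 ≤ dist p.1 c ^ 2 + p.2 ^ 2}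

/-- The hyperbolic volume of the ideal tetrahedron with vertices `∞` and the points of `s`. -/
def idealVolume (s : Set ℂ) : ℝ :=
  hyperbolicVolume.real (idealTetrahedron s)

/-- The prepotential: minus the sum over the faces of the volumes of the ideal tetrahedra above
them, as a function of the positions `x` of the vertices (the set of faces being kept fixed). -/
def prepotential {ι : Type*} (F : Finset (Finset ι)) (x : ι → ℂ) : ℝ :=
  - ∑ f ∈ F, idealVolume (x '' (f : Set ι))

/-- The Wirtinger derivative `∂g/∂z_u = (∂g/∂x_u - i ∂g/∂y_u) / 2`, where `z_u = x_u + i y_u`. -/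
def wirtinger {ι : Type*} [DecidableEq ι] (u : ι) (g : (ι → ℂ) → ℂ) (x : ι → ℂ) : ℂ :=
  (1 / 2) * (lineDeriv ℝ g x (Pi.single u 1) - Complex.I * lineDeriv ℝ g x (Pi.single u Complex.I))

/-- The Wirtinger derivative `∂g/∂z̄_u = (∂g/∂x_u + i ∂g/∂y_u) / 2`, where `z_u = x_u + i y_u`. -/
def wirtingerBar {ι : Type*} [DecidableEq ι] (u : ι) (g : (ι → ℂ) → ℂ) (x : ι → ℂ) : ℂ :=
  (1 / 2) * (lineDeriv ℝ g x (Pi.single u 1) + Complex.I * lineDeriv ℝ g x (Pi.single u Complex.I))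

/-- The Kähler matrix `D_{u v̄}(T) = ∂/∂z_u ∂/∂z̄_v 𝒜_T`, evaluated at the configuration `z`. -/
def kahlerMatrix {ι : Type*} [DecidableEq ι] {z : ι → ℂ} (T : PointTriangulation z) :
    Matrix ι ι ℂ :=
  Matrix.of fun u v =>
    wirtinger u (wirtingerBar v (fun x => (prepotential T.faces x : ℂ))) z

/-- `d_{(ijk)}(T)`: the determinant of the Kähler matrix with the rows and columns `i`, `j`, `k`
removed. -/
def kahlerMinor {ι : Type*} [Fintype ι] [DecidableEq ι] {z : ι → ℂ} (i j k : ι)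
    (T : PointTriangulation z) : ℂ :=
  ((kahlerMatrix T).submatrix
    (Subtype.val : {u : ι // u ≠ i ∧ u ≠ j ∧ u ≠ k} → ι)
    (Subtype.val : {u : ι // u ≠ i ∧ u ≠ j ∧ u ≠ k} → ι)).det

end

-- `a ≤ b` in `ℂ` means that `b - a` is a nonnegative real number.
open scoped ComplexOrder

/-!
The Hermitian form of `D(T)` sends a variation `φ` of the vertices to the sum over the faces
`a b c` of half the area form `orient` times `|Δ_{abc} φ|²`, where `Δ_{abc} φ` is the second
divided difference of `φ` at the vertices of the face; in particular `D(T)` is positive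
semidefinite. The alternating sum of these contributions over a tetrahedron `a b c d` is the
absolute square of the third divided difference of `φ`, times the power of `d` with respect to the
circle through `a`, `b`, `c`. Hence flipping an edge whose opposite vertex lies inside the
circumcircle does not decrease the form, and any two triangulations of a cocircular polygon have the
same form.

Triangulations enter only through their chains of oriented triangles, and the chains with a given
boundary form a finite set stable under flips. A chain maximising the form, perturbed so that flips
increase it strictly, admits no such flip, so it satisfies the empty circumdisc condition. The
difference of two chains with that condition splits into cycles of cocircular triangles, so their
forms agree. Thus `D(T^D) - D(T)` is positive semidefinite, and determinants of principal
submatrices are monotone for the Loewner order.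
-/

section Loewner

open scoped Matrix MatrixOrder

variable {𝕜 n : Type*} [RCLike 𝕜] [Fintype n] [DecidableEq n]

theorem one_le_det_one_add_of_posSemidef {P : Matrix n n 𝕜} (hP : P.PosSemidef) :
    1 ≤ (1 + P).det := by
  have hherm : (1 + P).IsHermitian := Matrix.isHermitian_one.add hP.isHermitian
  have heig (i : n) : 1 ≤ hherm.eigenvalues i := by
    have hmem : hherm.eigenvalues i - 1 ∈ spectrum ℝ P := by
      have := Set.sub_mem_sub (hherm.eigenvalues_mem_spectrum_real i) (Set.mem_singleton (1 : ℝ))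
      rwa [spectrum.sub_singleton_eq, map_one, add_sub_cancel_left] at this
    exact sub_nonneg.mp (spectrum_nonneg_of_nonneg hP.nonneg hmem)
  have hprod : (1 : ℝ) ≤ ∏ i, hherm.eigenvalues i := Finset.one_le_prod fun i _ => heig i
  rw [hherm.det_eq_prod_eigenvalues]
  exact_mod_cast hprod

theorem det_le_det_of_posSemidef {A B : Matrix n n 𝕜} (hA : A.PosSemidef)
    (hAB : (B - A).PosSemidef) : A.det ≤ B.det := by
  by_cases hdet : A.det = 0
  · rw [hdet, ← add_sub_cancel A B]
    exact (hA.add hAB).det_nonneg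
  obtain ⟨C, rfl⟩ := CStarAlgebra.nonneg_iff_eq_star_mul_self.mp hA.nonneg
  rw [Matrix.star_eq_conjTranspose, Matrix.det_mul] at *
  have hC : IsUnit C.det := isUnit_iff_ne_zero.mpr (right_ne_zero_of_mul hdet)
  set P := (C⁻¹)ᴴ * (B - Cᴴ * C) * C⁻¹
  have hP : P.PosSemidef := hAB.conjTranspose_mul_mul_same C⁻¹
  have hB : B = Cᴴ * (1 + P) * C := by
    have hCC : Cᴴ * (C⁻¹)ᴴ = 1 := by
      rw [← Matrix.conjTranspose_mul, Matrix.nonsing_inv_mul _ hC, Matrix.conjTranspose_one]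
    have hPC : Cᴴ * P * C = (Cᴴ * (C⁻¹)ᴴ) * (B - Cᴴ * C) * (C⁻¹ * C) := by
      simp only [P, Matrix.mul_assoc]
    rw [Matrix.mul_add, Matrix.add_mul, hPC, hCC, Matrix.nonsing_inv_mul _ hC]
    simp only [Matrix.one_mul, Matrix.mul_one, add_sub_cancel]
  have hCdet : 0 ≤ Cᴴ.det * C.det := by
    rw [← Matrix.det_mul]
    exact hA.det_nonneg
  calc Cᴴ.det * C.det ≤ Cᴴ.det * C.det * (1 + P).det :=
        le_mul_of_one_le_right hCdet (one_le_det_one_add_of_posSemidef hP)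
    _ = B.det := by
        rw [hB, Matrix.det_mul, Matrix.det_mul]
        ring

end Loewner

section PlaneGeometry

/-- Twice the signed area of the triangle `a b c`; it is positive exactly when `c` lies strictly to
the left of the directed line from `a` to `b`. -/
def orient (a b c : ℂ) : ℝ :=
  (b.re - a.re) * (c.im - a.im) - (b.im - a.im) * (c.re - a.re)

variable {a b c d o o' v w : ℂ}

theorem orient_rotate (a b c : ℂ) : orient b c a = orient a b c := by
  simp only [orient]
  ring

theorem orient_swap_left (a b c : ℂ) : orient b a c = -orient a b c := by
  simp only [orient]
  ring

theorem orient_swap_right (a b c : ℂ) : orient a c b = -orient a b c := by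
  simp only [orient]
  ring

@[simp] theorem orient_self_left (a c : ℂ) : orient a a c = 0 := by
  simp only [orient]
  ring

@[simp] theorem orient_self_right (a c : ℂ) : orient a c c = 0 := by
  simp only [orient]
  ring

@[simp] theorem orient_self_outer (a c : ℂ) : orient a c a = 0 := by
  simp only [orient]
  ring

theorem orient_add_orient_add_orient (a b c v : ℂ) :
    orient b c v + orient c a v + orient a b v = orient a b c := by
  simp only [orient]
  ring

theorem orient_mul_orient (a b c p q w : ℂ) :
    orient a b c * orient p q w =
      orient b c w * orient p q a + orient c a w * orient p q b + orient a b w * orient p q c := by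
  simp only [orient]
  ring

theorem ne_of_orient_ne_zero (h : orient a b c ≠ 0) : a ≠ b ∧ b ≠ c ∧ c ≠ a := by
  refine ⟨?_, ?_, ?_⟩ <;> rintro rfl <;> simp at h

theorem exists_lineMap_eq_of_orient_eq_zero (hab : a ≠ b) (h : orient a b c = 0) :
    ∃ s : ℝ, AffineMap.lineMap a b s = c := by
  have him : ((c - a) / (b - a)).im = 0 := by
    rw [Complex.div_im, ← sub_div, div_eq_zero_iff]
    left
    simp only [Complex.sub_re, Complex.sub_im]
    simp only [orient] at h
    linarith
  refine ⟨((c - a) / (b - a)).re, ?_⟩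
  have hre : (((c - a) / (b - a)).re : ℂ) = (c - a) / (b - a) :=
    Complex.ext (Complex.ofReal_re _) (by rw [Complex.ofReal_im, him])
  rw [AffineMap.lineMap_apply, vsub_eq_sub, vadd_eq_add, Complex.real_smul, hre,
    div_mul_cancel₀ _ (sub_ne_zero.mpr hab.symm), sub_add_cancel]

theorem collinear_of_orient_eq_zero (h : orient a b c = 0) : Collinear ℝ {a, b, c} := by
  rcases eq_or_ne a b with rfl | hab
  · rw [Set.insert_eq_of_mem (Set.mem_insert _ _)]
    exact collinear_pair ℝ a c
  · obtain ⟨s, rfl⟩ := exists_lineMap_eq_of_orient_eq_zero hab h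
    rw [Set.pair_comm, Set.insert_comm]
    exact collinear_insert_of_mem_affineSpan_pair (AffineMap.lineMap_mem_affineSpan_pair s a b)

theorem orient_ne_zero_of_affineIndependent (h : AffineIndependent ℝ ![a, b, c]) :
    orient a b c ≠ 0 := fun h0 =>
  affineIndependent_iff_not_collinear_set.mp h (collinear_of_orient_eq_zero h0)

/-- The power of the point `w` with respect to the circle with centre `o` through `a`. -/
def circlePower (o a w : ℂ) : ℝ := Complex.normSq (w - o) - Complex.normSq (a - o)

theorem circlePower_self (o a : ℂ) : circlePower o a a = 0 := sub_self _

theorem circlePower_eq_dist (o a w : ℂ) :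
    circlePower o a w = dist w o ^ 2 - dist a o ^ 2 := by
  rw [circlePower, dist_eq_norm, dist_eq_norm, Complex.normSq_eq_norm_sq, Complex.normSq_eq_norm_sq]

theorem circlePower_eq_zero_iff : circlePower o a w = 0 ↔ dist w o = dist a o := by
  rw [circlePower_eq_dist, sub_eq_zero, sq_eq_sq₀ dist_nonneg dist_nonneg]

theorem circlePower_nonneg_iff : 0 ≤ circlePower o a w ↔ dist a o ≤ dist w o := by
  rw [circlePower_eq_dist, sub_nonneg, sq_le_sq₀ dist_nonneg dist_nonneg]

theorem circlePower_base_eq (h : circlePower o a b = 0) (w : ℂ) :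
    circlePower o b w = circlePower o a w := by
  simp only [circlePower] at *
  linarith

theorem circlePower_comm_eq_zero (h : circlePower o a b = 0) : circlePower o b a = 0 := by
  rw [circlePower_base_eq h, circlePower_self]

theorem orient_ne_zero_of_circlePower_eq_zero (hb : circlePower o a b = 0)
    (hc : circlePower o a c = 0) (hab : a ≠ b) (hac : a ≠ c) (hbc : b ≠ c) :
    orient a b c ≠ 0 := by
  refine orient_ne_zero_of_affineIndependent
    (EuclideanGeometry.Cospherical.affineIndependent_of_ne ⟨o, dist a o, ?_⟩ hab hac hbc)
  rintro w (rfl | rfl | rfl)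
  exacts [rfl, circlePower_eq_zero_iff.mp hb, circlePower_eq_zero_iff.mp hc]

theorem exists_center_eq_add_of_circlePower_eq_zero (hab : a ≠ b) (h : circlePower o a b = 0)
    (h' : circlePower o' a b = 0) :
    ∃ t : ℝ, o'.re = o.re - t * (b.im - a.im) ∧ o'.im = o.im + t * (b.re - a.re) := by
  have hN : Complex.normSq (b - a) ≠ 0 := Complex.normSq_eq_zero.not.mpr (sub_ne_zero.mpr hab.symm)
  refine ⟨((b.re - a.re) * (o'.im - o.im) - (b.im - a.im) * (o'.re - o.re)) /
    Complex.normSq (b - a), ?_, ?_⟩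
  all_goals
    field_simp
    simp only [circlePower, Complex.normSq_apply, Complex.sub_re, Complex.sub_im] at *
  · linear_combination (b.re - a.re) / 2 * (h - h')
  · linear_combination (b.im - a.im) / 2 * (h - h')

theorem circlePower_sub_circlePower {t : ℝ} (hre : o'.re = o.re - t * (b.im - a.im))
    (him : o'.im = o.im + t * (b.re - a.re)) (w : ℂ) :
    circlePower o a w - circlePower o' a w = 2 * t * orient a b w := by
  simp only [circlePower, orient, Complex.normSq_apply, Complex.sub_re, Complex.sub_im, hre, him]
  ring

/-- The circumcentre of a triangle, with junk value `a` if the triangle is degenerate. -/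
noncomputable def circumcenter (a b c : ℂ) : ℂ :=
  ⟨a.re + ((c.im - a.im) * Complex.normSq (b - a) - (b.im - a.im) * Complex.normSq (c - a)) /
      (2 * orient a b c),
    a.im + ((b.re - a.re) * Complex.normSq (c - a) - (c.re - a.re) * Complex.normSq (b - a)) /
      (2 * orient a b c)⟩

/-- The power of `w` with respect to the circumcircle of `a b c`. -/
noncomputable def circumpower (a b c w : ℂ) : ℝ := circlePower (circumcenter a b c) a w

theorem circumpower_fst (a b c : ℂ) : circumpower a b c a = 0 := circlePower_self _ _

theorem circumpower_snd (h : orient a b c ≠ 0) : circumpower a b c b = 0 := by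
  simp only [circumpower, circlePower, circumcenter, Complex.normSq_apply, Complex.sub_re,
    Complex.sub_im]
  field_simp
  simp only [orient]
  ring

theorem circumpower_thd (h : orient a b c ≠ 0) : circumpower a b c c = 0 := by
  simp only [circumpower, circlePower, circumcenter, Complex.normSq_apply, Complex.sub_re,
    Complex.sub_im]
  field_simp
  simp only [orient]
  ring

theorem eq_circumcenter_of_circlePower_eq_zero (h : orient a b c ≠ 0)
    (hb : circlePower o a b = 0) (hc : circlePower o a c = 0) : o = circumcenter a b c := by
  obtain ⟨t, hre, him⟩ := exists_center_eq_add_of_circlePower_eq_zero (ne_of_orient_ne_zero h).1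
    (circumpower_snd h) hb
  have ht : 2 * t * orient a b c = 0 := by
    rw [← circlePower_sub_circlePower hre him, hc, sub_zero]
    exact circumpower_thd h
  obtain rfl : t = 0 := by simpa [h] using ht
  exact Complex.ext (by simpa using hre) (by simpa using him)

theorem circumcenter_rotate (h : orient a b c ≠ 0) :
    circumcenter b c a = circumcenter a b c := by
  have hb : circlePower (circumcenter a b c) a b = 0 := circumpower_snd h
  refine (eq_circumcenter_of_circlePower_eq_zero (by rwa [orient_rotate]) ?_ ?_).symm
  · rw [circlePower_base_eq hb]
    exact circumpower_thd h
  · exact circlePower_comm_eq_zero hb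

theorem circumpower_rotate (h : orient a b c ≠ 0) (w : ℂ) :
    circumpower b c a w = circumpower a b c w := by
  rw [circumpower, circumcenter_rotate h, circlePower_base_eq (circumpower_snd h), circumpower]

theorem orient_mul_circumpower (h : orient a b c ≠ 0) (w : ℂ) :
    orient a b c * circumpower a b c w =
      orient a b c * Complex.normSq (w - b) - orient b c w * Complex.normSq (b - a) -
        orient a b w * Complex.normSq (c - b) := by
  have hb := circumpower_snd h
  have hc := circumpower_thd h
  simp only [circumpower, circlePower, orient, Complex.normSq_apply, Complex.sub_re,
    Complex.sub_im] at *
  linear_combination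
    ((a.re - c.re) * (w.im - c.im) - (a.im - c.im) * (w.re - c.re)) * hb +
    ((b.re - a.re) * (w.im - a.im) - (b.im - a.im) * (w.re - a.re)) * hc

theorem circumpower_pos_of_orient_nonpos (h : 0 < orient a b c) (hab : orient a b v ≤ 0)
    (hbc : orient b c v ≤ 0) (hv : v ≠ b) : 0 < circumpower a b c v := by
  refine pos_of_mul_pos_right ?_ h.le
  rw [orient_mul_circumpower h.ne']
  have hvb := mul_pos h (Complex.normSq_pos.mpr (sub_ne_zero.mpr hv))
  have hba := mul_nonpos_of_nonpos_of_nonneg hbc (Complex.normSq_nonneg (b - a))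
  have hcb := mul_nonpos_of_nonpos_of_nonneg hab (Complex.normSq_nonneg (c - b))
  linarith

theorem orient_pos_of_circumpower_nonpos (h : 0 < orient a b c) (hab : orient a b v < 0)
    (hv : circumpower a b c v ≤ 0) : 0 < orient b c v ∧ 0 < orient c a v := by
  have hcab : 0 < orient c a b := by rwa [← orient_rotate]
  constructor <;> by_contra! hneg
  · have hvb : v ≠ b := by
      rintro rfl
      simp at hab
    exact hv.not_gt (circumpower_pos_of_orient_nonpos h hab.le hneg hvb)
  · have hva : v ≠ a := by
      rintro rfl
      simp at hab
    have := circumpower_pos_of_orient_nonpos hcab hneg hab.le hva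
    rw [← circumpower_rotate hcab.ne'] at this
    exact hv.not_gt this

theorem circumpower_le_of_orient_neg (habc : 0 < orient a b c) (hbad : 0 < orient b a d)
    (hd : 0 ≤ circumpower a b c d) (hw : orient a b w < 0) :
    circumpower b a d w ≤ circumpower a b c w ∧
      (circumpower b a d w = circumpower a b c w → circumcenter b a d = circumcenter a b c) := by
  have hb : circlePower (circumcenter a b c) a b = 0 := circumpower_snd habc.ne'
  have ha : circlePower (circumcenter b a d) b a = 0 := circumpower_snd hbad.ne'
  obtain ⟨t, hre, him⟩ := exists_center_eq_add_of_circlePower_eq_zero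
    (ne_of_orient_ne_zero habc.ne').1 hb (circlePower_comm_eq_zero ha)
  have hpencil (v : ℂ) : circumpower a b c v - circumpower b a d v = 2 * t * orient a b v := by
    rw [circumpower, circumpower, circlePower_base_eq (circlePower_comm_eq_zero ha),
      circlePower_sub_circlePower hre him]
  have ht : t ≤ 0 := by
    have hdt := hpencil d
    rw [circumpower_thd hbad.ne', sub_zero] at hdt
    rw [orient_swap_left] at hbad
    nlinarith
  constructor
  · nlinarith [hpencil w]
  · intro heq
    obtain rfl : t = 0 := by simpa [heq, hw.ne] using hpencil w
    exact Complex.ext (by simpa using hre) (by simpa using him)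

end PlaneGeometry

section Fillings

variable {ι : Type*} {z : ι → ℂ} {a b c d : ι}

/-- The triangle with vertices `z a`, `z b`, `z c` is positively oriented and contains no point of
the configuration `z` other than its vertices. -/
structure IsEmptyTriangle (z : ι → ℂ) (a b c : ι) : Prop where
  orient_pos : 0 < orient (z a) (z b) (z c)
  eq_or_eq_or_eq : ∀ v, 0 ≤ orient (z a) (z b) (z v) → 0 ≤ orient (z b) (z c) (z v) →
    0 ≤ orient (z c) (z a) (z v) → v = a ∨ v = b ∨ v = c

namespace IsEmptyTriangle

theorem rotate (h : IsEmptyTriangle z a b c) : IsEmptyTriangle z b c a where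
  orient_pos := by simpa only [orient_rotate] using h.orient_pos
  eq_or_eq_or_eq v hbc hca hab := by
    have := h.eq_or_eq_or_eq v hab hbc hca
    tauto

theorem ne (h : IsEmptyTriangle z a b c) : a ≠ b ∧ b ≠ c ∧ c ≠ a := by
  have hz := ne_of_orient_ne_zero h.orient_pos.ne'
  exact ⟨ne_of_apply_ne z hz.1, ne_of_apply_ne z hz.2.1, ne_of_apply_ne z hz.2.2⟩

end IsEmptyTriangle

theorem orient_nonneg_or_orient_nonneg_of_convex_quadrilateral {a b c d w : ℂ}
    (habc : 0 < orient a b c) (hbad : 0 < orient b a d) (hadc : 0 < orient a d c)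
    (hdbc : 0 < orient d b c) (had : 0 ≤ orient a d w) (hdc : 0 ≤ orient d c w)
    (hca : 0 ≤ orient c a w) :
    (0 ≤ orient a b w ∧ 0 ≤ orient b c w) ∨ (0 ≤ orient b a w ∧ 0 ≤ orient d b w) := by
  rcases le_total 0 (orient a b w) with hab | hab
  · refine Or.inl ⟨hab, nonneg_of_mul_nonneg_right ?_ hadc⟩
    rw [orient_mul_orient a d c b c w, orient_self_right, orient_rotate a b c, orient_rotate d b c]
    positivity
  · refine Or.inr ⟨by rwa [orient_swap_left, neg_nonneg], nonneg_of_mul_nonneg_right ?_ hadc⟩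
    rw [orient_mul_orient a d c d b w, orient_self_outer, ← orient_rotate d b a]
    positivity

theorem IsEmptyTriangle.flip (habc : IsEmptyTriangle z a b c) (hbad : IsEmptyTriangle z b a d)
    (hadc : 0 < orient (z a) (z d) (z c)) (hdbc : 0 < orient (z d) (z b) (z c)) :
    IsEmptyTriangle z a d c where
  orient_pos := hadc
  eq_or_eq_or_eq v had hdc hca := by
    have hb : v ≠ b := by
      rintro rfl
      rw [orient_swap_right] at hdc
      linarith
    rcases orient_nonneg_or_orient_nonneg_of_convex_quadrilateral habc.orient_pos hbad.orient_pos
      hadc hdbc had hdc hca with ⟨hab, hbc⟩ | ⟨hba, hdb⟩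
    · have := habc.eq_or_eq_or_eq v hab hbc hca
      tauto
    · have := hbad.eq_or_eq_or_eq v hba had hdb
      tauto

section triangleChain

variable [DecidableEq ι]

/-- The elementary chain of the oriented triangle `a b c`: the indicator function of the three
cyclic rotations of `(a, b, c)`. -/
def triangleChain (a b c x y w : ι) : ℤ :=
  (if x = a ∧ y = b ∧ w = c then 1 else 0) + (if x = b ∧ y = c ∧ w = a then 1 else 0) +
    (if x = c ∧ y = a ∧ w = b then 1 else 0)

theorem triangleChain_rotate (a b c x y w : ι) :
    triangleChain a b c y w x = triangleChain a b c x y w := by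
  simp only [triangleChain, and_comm, and_left_comm]
  ring

theorem triangleChain_nonneg (a b c x y w : ι) : 0 ≤ triangleChain a b c x y w := by
  unfold triangleChain
  positivity

theorem eq_of_triangleChain_ne_zero {x y w : ι} (h : triangleChain a b c x y w ≠ 0) :
    (x = a ∧ y = b ∧ w = c) ∨ (x = b ∧ y = c ∧ w = a) ∨ (x = c ∧ y = a ∧ w = b) := by
  by_contra! hcon
  apply h
  rw [triangleChain, if_neg (by tauto), if_neg (by tauto), if_neg (by tauto)]
  rfl

theorem triangleChain_add_triangleChain_le_one (hab : a ≠ b) (hcd : c ≠ d) (x y w : ι) :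
    triangleChain a b c x y w + triangleChain b a d x y w ≤ 1 := by
  simp only [triangleChain]
  grind

theorem sum_triangleChain [Fintype ι] (a b c x y : ι) :
    ∑ w, triangleChain a b c x y w =
      (if x = a ∧ y = b then 1 else 0) + (if x = b ∧ y = c then 1 else 0) +
        (if x = c ∧ y = a then 1 else 0) := by
  simp only [triangleChain, Finset.sum_add_distrib, ← and_assoc, ite_and _ (_ = _)]
  simp

theorem sum_triangleChain_mul [Fintype ι] (a b c : ι) (W : ι → ι → ι → ℝ)
    (hW : ∀ a b c, W b c a = W a b c) :
    ∑ x, ∑ y, ∑ w, (triangleChain a b c x y w : ℝ) * W x y w = 3 * W a b c := by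
  have hsum (p q r : ι) : ∑ x, ∑ y, ∑ w, (if x = p ∧ y = q ∧ w = r then W x y w else 0) =
      W p q r := by
    simp [ite_and]
  simp only [triangleChain, Int.cast_add, Int.cast_ite, Int.cast_one, Int.cast_zero, add_mul,
    ite_mul, one_mul, zero_mul, Finset.sum_add_distrib, hsum, hW c a b, hW a b c]
  ring

end triangleChain

variable [Fintype ι]

theorem sum_rotate {M : Type*} [AddCommMonoid M] (F : ι → ι → ι → M) :
    ∑ a, ∑ b, ∑ c, F b c a = ∑ a, ∑ b, ∑ c, F a b c := by
  rw [Finset.sum_comm]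
  exact Finset.sum_congr rfl fun _ _ => Finset.sum_comm

/-- The discrete Stokes formula; the factors account for `x` being summed over oriented edges and
the coboundary over the three rotations of each triangle. -/
theorem sum_mul_coboundary (m : ι → ι → ι → ℝ) (hm : ∀ a b c, m b c a = m a b c)
    (x : ι → ι → ℝ) (hx : ∀ a b, x b a = -x a b) :
    2 * ∑ a, ∑ b, ∑ c, m a b c * (x a b + x b c + x c a) =
      3 * ∑ a, ∑ b, (∑ c, m a b c - ∑ c, m b a c) * x a b := by
  have hbc : ∑ a, ∑ b, ∑ c, m a b c * x b c = ∑ a, ∑ b, ∑ c, m a b c * x a b := by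
    rw [← sum_rotate (fun a b c => m a b c * x a b)]
    simp only [hm]
  have hca : ∑ a, ∑ b, ∑ c, m a b c * x c a = ∑ a, ∑ b, ∑ c, m a b c * x a b := by
    rw [← sum_rotate (fun a b c => m a b c * x c a)]
    simp only [hm]
  have hswap : ∑ a, ∑ b, (∑ c, m b a c) * x a b = -∑ a, ∑ b, (∑ c, m a b c) * x a b := by
    rw [Finset.sum_comm]
    simp only [← Finset.sum_neg_distrib, ← mul_neg, ← hx]
  simp only [mul_add, Finset.sum_add_distrib, hbc, hca, sub_mul, Finset.sum_sub_distrib, hswap,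
    ← Finset.sum_mul]
  ring

/-- A nonnegative integral chain `m` of empty triangles of the configuration `z` with boundary `B`.
A chain is a function of ordered triples that is invariant under rotation, so each triangle counts
three times in a sum over triples. -/
structure IsFilling (z : ι → ℂ) (B : ι → ι → ℤ) (m : ι → ι → ι → ℤ) : Prop where
  nonneg : ∀ a b c, 0 ≤ m a b c
  rotate : ∀ a b c, m b c a = m a b c
  isEmptyTriangle : ∀ {a b c}, m a b c ≠ 0 → IsEmptyTriangle z a b c
  boundary : ∀ a b, ∑ c, m a b c - ∑ c, m b a c = B a b

namespace IsFilling

variable {B : ι → ι → ℤ} {m : ι → ι → ι → ℤ}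

theorem orient_pos (h : IsFilling z B m) (hm : m a b c ≠ 0) : 0 < orient (z a) (z b) (z c) :=
  (h.isEmptyTriangle hm).orient_pos

theorem exists_ne_zero_of_boundary_nonpos (h : IsFilling z B m) (hm : m a b c ≠ 0)
    (hB : B a b ≤ 0) : ∃ d, m b a d ≠ 0 := by
  by_contra! hzero
  have hsum := h.boundary a b
  simp only [hzero, Finset.sum_const_zero, sub_zero] at hsum
  have hle : m a b c ≤ ∑ c, m a b c :=
    Finset.single_le_sum (fun c _ => h.nonneg a b c) (Finset.mem_univ c)
  have := h.nonneg a b c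
  lia

theorem two_mul_sum_mul_orient (h : IsFilling z B m) :
    2 * ∑ a, ∑ b, ∑ c, (m a b c : ℝ) * orient (z a) (z b) (z c) =
      3 * ∑ a, ∑ b, (B a b : ℝ) * orient 0 (z a) (z b) := by
  have hcoboundary (a b c : ι) : orient (z a) (z b) (z c) =
      orient 0 (z a) (z b) + orient 0 (z b) (z c) + orient 0 (z c) (z a) := by
    simp only [orient, Complex.zero_re, Complex.zero_im]
    ring
  simp only [← h.boundary, Int.cast_sub, Int.cast_sum, hcoboundary]
  exact sum_mul_coboundary (fun a b c => (m a b c : ℝ)) (fun a b c => by rw [h.rotate])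
    (fun a b => orient 0 (z a) (z b)) (fun a b => orient_swap_right _ _ _)

theorem mul_orient_nonneg (h : IsFilling z B m) (a b c : ι) :
    0 ≤ (m a b c : ℝ) * orient (z a) (z b) (z c) := by
  by_cases hm : m a b c = 0
  · simp [hm]
  · exact mul_nonneg (by exact_mod_cast h.nonneg a b c) (h.orient_pos hm).le

theorem mul_orient_le (h : IsFilling z B m) (a b c : ι) :
    (m a b c : ℝ) * orient (z a) (z b) (z c) ≤
      3 / 2 * ∑ a, ∑ b, (B a b : ℝ) * orient 0 (z a) (z b) := by
  have hle := Finset.single_le_sum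
    (f := fun p : ι × ι × ι => (m p.1 p.2.1 p.2.2 : ℝ) * orient (z p.1) (z p.2.1) (z p.2.2))
    (fun p _ => h.mul_orient_nonneg _ _ _) (Finset.mem_univ (a, b, c))
  simp only [Fintype.sum_prod_type] at hle
  linarith [h.two_mul_sum_mul_orient]

variable (z B) in
theorem finite_setOf : {m | IsFilling z B m}.Finite := by
  classical
  let S : ℝ := 3 / 2 * ∑ a, ∑ b, (B a b : ℝ) * orient 0 (z a) (z b)
  refine (Set.finite_Icc 0 fun a b c => max 0 ⌈S / orient (z a) (z b) (z c)⌉).subset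
    fun m h => ⟨fun a b c => h.nonneg a b c, fun a b c => ?_⟩
  by_cases hm : m a b c = 0
  · exact hm.trans_le (le_max_left _ _)
  · refine le_max_of_le_right (Int.cast_le.mp (le_trans ?_ (Int.le_ceil _)))
    exact (le_div_iff₀ (h.orient_pos hm)).mpr (h.mul_orient_le a b c)

variable [DecidableEq ι]

theorem one_le_of_triangleChain_ne_zero (h : IsFilling z B m) (hm : m a b c ≠ 0) {x y w : ι}
    (hT : triangleChain a b c x y w ≠ 0) : 1 ≤ m x y w := by
  have hpos : 1 ≤ m a b c := lt_of_le_of_ne (h.nonneg a b c) hm.symm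
  rcases eq_of_triangleChain_ne_zero hT with ⟨rfl, rfl, rfl⟩ | ⟨rfl, rfl, rfl⟩ | ⟨rfl, rfl, rfl⟩
  · exact hpos
  · rwa [h.rotate]
  · rwa [← h.rotate]

/-- The chain obtained from `m` by replacing the triangles `a b c` and `b a d` by `a d c` and
`d b c`, that is by flipping the diagonal `a b` of the quadrilateral `a d b c`. -/
def flip (m : ι → ι → ι → ℤ) (a b c d x y w : ι) : ℤ :=
  m x y w - triangleChain a b c x y w - triangleChain b a d x y w +
    triangleChain a d c x y w + triangleChain d b c x y w

theorem triangleChain_add_triangleChain_le (h : IsFilling z B m) (habc : m a b c ≠ 0)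
    (hbad : m b a d ≠ 0) (x y w : ι) :
    triangleChain a b c x y w + triangleChain b a d x y w ≤ m x y w := by
  have hcd : c ≠ d := by
    rintro rfl
    have := h.orient_pos hbad
    rw [orient_swap_left] at this
    linarith [h.orient_pos habc]
  have hle := triangleChain_add_triangleChain_le_one (h.isEmptyTriangle habc).ne.1 hcd x y w
  by_cases hT : triangleChain a b c x y w = 0
  · by_cases hT' : triangleChain b a d x y w = 0
    · simpa [hT, hT'] using h.nonneg x y w
    · exact hle.trans (h.one_le_of_triangleChain_ne_zero hbad hT')
  · exact hle.trans (h.one_le_of_triangleChain_ne_zero habc hT)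

theorem isFilling_flip (h : IsFilling z B m) (habc : m a b c ≠ 0) (hbad : m b a d ≠ 0)
    (hadc : 0 < orient (z a) (z d) (z c)) (hdbc : 0 < orient (z d) (z b) (z c)) :
    IsFilling z B (flip m a b c d) := by
  have hle := h.triangleChain_add_triangleChain_le habc hbad
  have hEadc : IsEmptyTriangle z a d c :=
    (h.isEmptyTriangle habc).flip (h.isEmptyTriangle hbad) hadc hdbc
  have hEdbc : IsEmptyTriangle z b c d := by
    refine (h.isEmptyTriangle hbad).flip (h.isEmptyTriangle habc) ?_ ?_
    · rwa [orient_rotate]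
    · rwa [← orient_rotate (z c)]
  have hchain {p q r x y w : ι} (hE : IsEmptyTriangle z p q r)
      (hT : triangleChain p q r x y w ≠ 0) : IsEmptyTriangle z x y w := by
    rcases eq_of_triangleChain_ne_zero hT with ⟨rfl, rfl, rfl⟩ | ⟨rfl, rfl, rfl⟩ | ⟨rfl, rfl, rfl⟩
    exacts [hE, hE.rotate, hE.rotate.rotate]
  refine ⟨fun x y w => ?_, fun x y w => ?_, fun {x y w} hne => ?_, fun x y => ?_⟩
  · simp only [flip]
    linarith [hle x y w, triangleChain_nonneg a d c x y w, triangleChain_nonneg d b c x y w]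
  · simp only [flip, triangleChain_rotate, h.rotate]
  · by_cases hm : m x y w = 0
    · by_cases hT : triangleChain a d c x y w = 0
      · refine hchain hEdbc.rotate.rotate fun hT' => hne ?_
        have := hle x y w
        have := triangleChain_nonneg a b c x y w
        have := triangleChain_nonneg b a d x y w
        simp only [flip]
        lia
      · exact hchain hEadc hT
    · exact h.isEmptyTriangle hm
  · rw [← h.boundary x y]
    simp only [flip, Finset.sum_add_distrib, Finset.sum_sub_distrib, sum_triangleChain,
      and_comm (a := y = _)]
    ring

theorem sum_flip_mul (m : ι → ι → ι → ℤ) (a b c d : ι) (W : ι → ι → ι → ℝ)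
    (hW : ∀ a b c, W b c a = W a b c) :
    ∑ x, ∑ y, ∑ w, (flip m a b c d x y w : ℝ) * W x y w =
      ∑ x, ∑ y, ∑ w, (m x y w : ℝ) * W x y w +
        3 * (W a d c + W d b c - W a b c - W b a d) := by
  simp only [flip, Int.cast_add, Int.cast_sub, add_mul, sub_mul, Finset.sum_add_distrib,
    Finset.sum_sub_distrib, sum_triangleChain_mul _ _ _ W hW]
  ring

end IsFilling

end Fillings

section LocalToGlobal

variable {ι : Type*} {z : ι → ℂ} {a b c d w : ι}

theorem IsEmptyTriangle.orient_neg_of_circumpower_neg (h : IsEmptyTriangle z a b c)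
    (hw : circumpower (z a) (z b) (z c) (z w) < 0) :
    orient (z a) (z b) (z w) < 0 ∨ orient (z b) (z c) (z w) < 0 ∨ orient (z c) (z a) (z w) < 0 := by
  by_contra! hcon
  rcases h.eq_or_eq_or_eq w hcon.1 hcon.2.1 hcon.2.2 with rfl | rfl | rfl
  · exact hw.ne (circumpower_fst _ _ _)
  · exact hw.ne (circumpower_snd h.orient_pos.ne')
  · exact hw.ne (circumpower_thd h.orient_pos.ne')

variable [Fintype ι]

/-- The points of the configuration that lie on the circumcircle of `a b c` beyond the edge
`a b`. -/
noncomputable def capPoints (z : ι → ℂ) (a b c : ι) : Finset ι :=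
  open scoped Classical in
  {v | orient (z a) (z b) (z v) < 0 ∧ circumpower (z a) (z b) (z c) (z v) = 0}

theorem mem_capPoints {v : ι} : v ∈ capPoints z a b c ↔
    orient (z a) (z b) (z v) < 0 ∧ circumpower (z a) (z b) (z c) (z v) = 0 := by
  simp [capPoints]

theorem capPoints_ssubset (hbad : 0 < orient (z b) (z a) (z d))
    (hpow : circumpower (z b) (z a) (z d) = circumpower (z a) (z b) (z c)) :
    capPoints z a d b ⊂ capPoints z a b c ∧ capPoints z d b a ⊂ capPoints z a b c := by
  have hadb : 0 < orient (z a) (z d) (z b) := by rwa [orient_rotate]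
  have hdba : 0 < orient (z d) (z b) (z a) := by rwa [orient_rotate]
  have hpow' : circumpower (z a) (z d) (z b) = circumpower (z a) (z b) (z c) := by
    rw [← hpow]
    exact funext (circumpower_rotate hbad.ne')
  have hpow'' : circumpower (z d) (z b) (z a) = circumpower (z a) (z b) (z c) := by
    rw [← hpow']
    exact funext (circumpower_rotate hadb.ne')
  have hd : d ∈ capPoints z a b c := by
    refine mem_capPoints.mpr ⟨?_, ?_⟩
    · rwa [orient_swap_left, neg_lt_zero]
    · rw [← hpow, circumpower_thd hbad.ne']
  have hcap {v : ι} (hba : 0 < orient (z b) (z a) (z v))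
      (hv : circumpower (z a) (z b) (z c) (z v) = 0) : v ∈ capPoints z a b c :=
    mem_capPoints.mpr ⟨by rwa [orient_swap_left, neg_lt_zero], hv⟩
  constructor
  all_goals
    refine (Finset.ssubset_iff_of_subset fun v hv => ?_).mpr
      ⟨d, hd, fun hd' => (mem_capPoints.mp hd').1.ne (by simp)⟩
    obtain ⟨hneg, hzero⟩ := mem_capPoints.mp hv
  · rw [hpow'] at hzero
    exact hcap (orient_pos_of_circumpower_nonpos hadb hneg (by rw [hpow', hzero])).2 hzero
  · rw [hpow''] at hzero
    exact hcap (orient_pos_of_circumpower_nonpos hdba hneg (by rw [hpow'', hzero])).1 hzero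

namespace IsFilling

variable {B : ι → ι → ℤ} {m : ι → ι → ι → ℤ}

/-- One step of the walk towards a point `w` in the circumdisc of `a b c` beyond the edge `a b`. -/
theorem exists_toLex_lt (h : IsFilling z B m)
    (hloc : ∀ a b c d, m a b c ≠ 0 → m b a d ≠ 0 → 0 ≤ circumpower (z a) (z b) (z c) (z d))
    (hm : m a b c ≠ 0) (hB : B a b ≤ 0) (hab : orient (z a) (z b) (z w) < 0)
    (hw : circumpower (z a) (z b) (z c) (z w) < 0) :
    ∃ p q r, m p q r ≠ 0 ∧ orient (z p) (z q) (z w) < 0 ∧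
      circumpower (z p) (z q) (z r) (z w) < 0 ∧
      toLex (circumpower (z p) (z q) (z r) (z w), capPoints z p q r) <
        toLex (circumpower (z a) (z b) (z c) (z w), capPoints z a b c) := by
  obtain ⟨d, hd⟩ := h.exists_ne_zero_of_boundary_nonpos hm hB
  have habc := h.orient_pos hm
  have hbad := h.orient_pos hd
  have hadb : 0 < orient (z a) (z d) (z b) := by rwa [orient_rotate]
  obtain ⟨hle, heq⟩ := circumpower_le_of_orient_neg habc hbad (hloc a b c d hm hd) hab
  have hpow (hw' : circumpower (z b) (z a) (z d) (z w) = circumpower (z a) (z b) (z c) (z w)) :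
      circumpower (z b) (z a) (z d) = circumpower (z a) (z b) (z c) := by
    funext v
    rw [circumpower, heq hw', circlePower_base_eq (circumpower_snd habc.ne'), circumpower]
  have hrot := circumpower_rotate hbad.ne' (z w)
  have hrot' := (circumpower_rotate hadb.ne' (z w)).trans hrot
  rcases (h.isEmptyTriangle hd).orient_neg_of_circumpower_neg (hle.trans_lt hw) with
    hba | had | hdb
  · rw [orient_swap_left] at hba
    linarith
  · refine ⟨a, d, b, by rwa [h.rotate], had, by linarith, Prod.Lex.toLex_lt_toLex.mpr ?_⟩
    rw [hrot]
    exact hle.lt_or_eq.imp_right fun hw' => ⟨hw', (capPoints_ssubset hbad (hpow hw')).1⟩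
  · refine ⟨d, b, a, by rwa [← h.rotate], hdb, by linarith, Prod.Lex.toLex_lt_toLex.mpr ?_⟩
    rw [hrot']
    exact hle.lt_or_eq.imp_right fun hw' => ⟨hw', (capPoints_ssubset hbad (hpow hw')).2⟩

theorem circumpower_nonneg_of_local (h : IsFilling z B m)
    (hB : ∀ a b, 0 < B a b → ∀ v, 0 ≤ orient (z a) (z b) (z v))
    (hloc : ∀ a b c d, m a b c ≠ 0 → m b a d ≠ 0 → 0 ≤ circumpower (z a) (z b) (z c) (z d))
    (hm : m a b c ≠ 0) (w : ι) : 0 ≤ circumpower (z a) (z b) (z c) (z w) := by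
  by_contra! hw
  let P : Set (ι × ι × ι) := {t | m t.1 t.2.1 t.2.2 ≠ 0 ∧ orient (z t.1) (z t.2.1) (z w) < 0 ∧
    circumpower (z t.1) (z t.2.1) (z t.2.2) (z w) < 0}
  have hP : P.Nonempty := by
    have habc := (h.orient_pos hm).ne'
    have hbca : orient (z b) (z c) (z a) ≠ 0 := by rwa [orient_rotate]
    rcases (h.isEmptyTriangle hm).orient_neg_of_circumpower_neg hw with hab | hbc | hca
    · exact ⟨(a, b, c), hm, hab, hw⟩
    · exact ⟨(b, c, a), by rwa [h.rotate], hbc, by rwa [circumpower_rotate habc]⟩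
    · exact ⟨(c, a, b), by rwa [← h.rotate], hca,
        by rwa [circumpower_rotate hbca, circumpower_rotate habc]⟩
  obtain ⟨⟨a, b, c⟩, ⟨hm, hab, hw⟩, hmin⟩ := P.toFinite.exists_minimalFor
    (fun t => toLex (circumpower (z t.1) (z t.2.1) (z t.2.2) (z w), capPoints z t.1 t.2.1 t.2.2))
    P hP
  have hBab : B a b ≤ 0 := by
    by_contra! hpos
    exact (hB a b hpos w).not_gt hab
  obtain ⟨p, q, r, hm', hpq, hw', hlt⟩ := h.exists_toLex_lt hloc hm hBab hab hw
  exact hlt.not_ge (hmin (j := (p, q, r)) ⟨hm', hpq, hw'⟩ hlt.le)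

end IsFilling

end LocalToGlobal

section DelaunayCycle

/-- The lexicographic order on `ℂ`: real parts are compared first. -/
def lexKey (w : ℂ) : ℝ ×ₗ ℝ := toLex (w.re, w.im)

theorem lexKey_injective : Function.Injective lexKey := fun v w h => by
  rw [lexKey, lexKey, toLex_inj, Prod.mk.injEq] at h
  exact Complex.ext h.1 h.2

/-- Both circles pass through `a` and `b`, so `o' - o = t * I * (b - a)` for some real `t`; the two
comparisons force `t < 0`, which puts the points of the first circle outside the second on the left
of `a b`. -/
theorem orient_nonneg_of_lexKey_le {o o' a b w : ℂ} (hba : lexKey b < lexKey a)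
    (hoo' : lexKey (Complex.I * o') ≤ lexKey (Complex.I * o)) (hne : o' ≠ o)
    (hb : circlePower o a b = 0) (hb' : circlePower o' a b = 0) (hw : circlePower o a w = 0)
    (hw' : 0 ≤ circlePower o' a w) : 0 ≤ orient a b w := by
  have hab : a ≠ b := ne_of_apply_ne lexKey hba.ne'
  obtain ⟨t, hre, him⟩ := exists_center_eq_add_of_circlePower_eq_zero hab hb hb'
  have ht0 : t ≠ 0 := by
    rintro rfl
    exact hne (Complex.ext (by simpa using hre) (by simpa using him))
  have ht : t < 0 := by
    refine lt_of_le_of_ne (not_lt.mp fun hpos => ?_) ht0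
    simp only [lexKey, Prod.Lex.toLex_lt_toLex, Prod.Lex.toLex_le_toLex, Complex.mul_re,
      Complex.mul_im, Complex.I_re, Complex.I_im, hre, him] at hba hoo'
    rcases hba with hlt | ⟨heq, hlt⟩ <;> rcases hoo' with hlt' | ⟨heq', hle⟩ <;> nlinarith
  have hpencil := circlePower_sub_circlePower hre him w
  nlinarith

theorem exists_ne_ne_zero_of_sum_eq_zero {α M : Type*} [AddCommMonoid M] {s : Finset α}
    {f : α → M} (hs : ∑ i ∈ s, f i = 0) {i : α} (hi : i ∈ s) (hf : f i ≠ 0) :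
    ∃ j, j ≠ i ∧ f j ≠ 0 := by
  by_contra! hzero
  rw [Finset.sum_eq_single i (fun j _ hj => hzero j hj) (absurd hi)] at hs
  exact hf hs

variable {ι : Type*} {z : ι → ℂ} {δ : ι → ι → ι → ℝ} {a b c : ι} {o : ℂ}

open scoped Classical in
/-- The part of a chain made of the triangles with circumcentre `o`. For triangles with empty
circumdisc a common circumcentre means a common circumcircle. -/
noncomputable def cocircularPart (z : ι → ℂ) (δ : ι → ι → ι → ℝ) (o : ℂ) (a b c : ι) : ℝ :=
  if circumcenter (z a) (z b) (z c) = o then δ a b c else 0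

theorem of_cocircularPart_ne_zero (h : cocircularPart z δ o a b c ≠ 0) :
    δ a b c ≠ 0 ∧ circumcenter (z a) (z b) (z c) = o := by
  unfold cocircularPart at h
  split_ifs at h with ho
  · exact ⟨h, ho⟩
  · exact absurd rfl h

variable [Fintype ι]

open scoped Classical in
/-- The circumcentres of all triples of points of a configuration. -/
noncomputable def circumcenters (z : ι → ℂ) : Finset ℂ :=
  Finset.univ.image fun t : ι × ι × ι => circumcenter (z t.1) (z t.2.1) (z t.2.2)

variable (z) in
theorem circumcenter_mem_circumcenters (a b c : ι) :
    circumcenter (z a) (z b) (z c) ∈ circumcenters z :=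
  Finset.mem_image.mpr ⟨(a, b, c), Finset.mem_univ _, rfl⟩

theorem sum_cocircularPart (z : ι → ℂ) (δ : ι → ι → ι → ℝ) (a b c : ι) :
    ∑ o ∈ circumcenters z, cocircularPart z δ o a b c = δ a b c := by
  simp [cocircularPart, circumcenter_mem_circumcenters]

/-- The boundary of the part of a chain made of the triangles with circumcentre `o`. -/
noncomputable def cocircularBoundary (z : ι → ℂ) (δ : ι → ι → ι → ℝ) (o : ℂ) (a b : ι) : ℝ :=
  ∑ c, cocircularPart z δ o a b c - ∑ c, cocircularPart z δ o b a c

theorem cocircularBoundary_swap (z : ι → ℂ) (δ : ι → ι → ι → ℝ) (o : ℂ) (a b : ι) :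
    cocircularBoundary z δ o b a = -cocircularBoundary z δ o a b := by
  simp only [cocircularBoundary, neg_sub]

/-- A real cycle of triangles with empty circumdiscs, such as the difference of two Delaunay
triangulations. -/
structure IsDelaunayCycle (z : ι → ℂ) (δ : ι → ι → ι → ℝ) : Prop where
  rotate : ∀ a b c, δ b c a = δ a b c
  orient_pos : ∀ {a b c}, δ a b c ≠ 0 → 0 < orient (z a) (z b) (z c)
  circumpower_nonneg : ∀ {a b c}, δ a b c ≠ 0 → ∀ w, 0 ≤ circumpower (z a) (z b) (z c) (z w)
  sum_eq_sum_swap : ∀ a b, ∑ c, δ a b c = ∑ c, δ b a c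

namespace IsDelaunayCycle

theorem cocircularPart_rotate (h : IsDelaunayCycle z δ) (o : ℂ) (a b c : ι) :
    cocircularPart z δ o b c a = cocircularPart z δ o a b c := by
  unfold cocircularPart
  rw [h.rotate]
  by_cases hδ : δ a b c = 0
  · simp [hδ]
  · rw [circumcenter_rotate (h.orient_pos hδ).ne']

theorem sum_circumcenters_cocircularBoundary (h : IsDelaunayCycle z δ) (a b : ι) :
    ∑ o ∈ circumcenters z, cocircularBoundary z δ o a b = 0 := by
  simp only [cocircularBoundary, Finset.sum_sub_distrib]
  rw [Finset.sum_comm, Finset.sum_comm (s := circumcenters z)]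
  simp only [sum_cocircularPart, h.sum_eq_sum_swap a b, sub_self]

theorem sum_cocircularBoundary (h : IsDelaunayCycle z δ) (o : ℂ) (a : ι) :
    ∑ b, cocircularBoundary z δ o a b = 0 := by
  simp only [cocircularBoundary, Finset.sum_sub_distrib]
  rw [Finset.sum_comm (f := fun b c => cocircularPart z δ o b a c), sub_eq_zero]
  simp only [h.cocircularPart_rotate o _ a]

theorem circlePower_nonneg_of_cocircularBoundary_ne_zero (h : IsDelaunayCycle z δ)
    (hab : cocircularBoundary z δ o a b ≠ 0) :
    o ∈ circumcenters z ∧ z a ≠ z b ∧ circlePower o (z a) (z b) = 0 ∧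
      ∀ w, 0 ≤ circlePower o (z a) (z w) := by
  have hex : (∃ c, cocircularPart z δ o a b c ≠ 0) ∨ ∃ c, cocircularPart z δ o b a c ≠ 0 := by
    by_contra! hzero
    simp [cocircularBoundary, hzero] at hab
  rcases hex with ⟨c, hc⟩ | ⟨c, hc⟩ <;> obtain ⟨hδ, rfl⟩ := of_cocircularPart_ne_zero hc <;>
    have hne := (h.orient_pos hδ).ne'
  · exact ⟨circumcenter_mem_circumcenters z a b c, (ne_of_orient_ne_zero hne).1,
      circumpower_snd hne, h.circumpower_nonneg hδ⟩
  · refine ⟨circumcenter_mem_circumcenters z b a c, (ne_of_orient_ne_zero hne).1.symm,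
      circlePower_comm_eq_zero (circumpower_snd hne), fun w => ?_⟩
    rw [circlePower_base_eq (circumpower_snd hne)]
    exact h.circumpower_nonneg hδ w

/-- At the lexicographically last vertex of the boundary of a cocircular part whose circle is itself
extremal, every boundary edge has all of the circle on its left; two such edges cannot exist, while
one alone is not a cycle. -/
theorem cocircularBoundary_eq_zero (h : IsDelaunayCycle z δ) (hz : Function.Injective z)
    (o : ℂ) (a b : ι) : cocircularBoundary z δ o a b = 0 := by
  by_contra hne
  let E : Set ℂ := {o | ∃ a b, cocircularBoundary z δ o a b ≠ 0}
  have hE : E.Finite := (circumcenters z).finite_toSet.subset fun o ⟨a, b, ho⟩ =>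
    (h.circlePower_nonneg_of_cocircularBoundary_ne_zero ho).1
  obtain ⟨o, ⟨a, b, hab⟩, hmax⟩ := E.exists_max_image (fun o => lexKey (Complex.I * o)) hE
    ⟨o, a, b, hne⟩
  let V : Set ι := {a | ∃ b, cocircularBoundary z δ o a b ≠ 0}
  obtain ⟨a, ⟨b, hab⟩, htop⟩ := V.exists_max_image (fun a => lexKey (z a)) V.toFinite ⟨a, b, hab⟩
  have hleft {b b' : ι} (hb : cocircularBoundary z δ o a b ≠ 0)
      (hb' : circlePower o (z a) (z b') = 0) : 0 ≤ orient (z a) (z b) (z b') := by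
    obtain ⟨hmem, hne, hpow, -⟩ := h.circlePower_nonneg_of_cocircularBoundary_ne_zero hb
    obtain ⟨o', ho', hoo'⟩ := exists_ne_ne_zero_of_sum_eq_zero
      (h.sum_circumcenters_cocircularBoundary a b) hmem hb
    obtain ⟨-, -, hpow', hempty⟩ := h.circlePower_nonneg_of_cocircularBoundary_ne_zero hoo'
    have hbV : b ∈ V := ⟨a, by rwa [cocircularBoundary_swap, neg_ne_zero]⟩
    exact orient_nonneg_of_lexKey_le
      (lt_of_le_of_ne (htop b hbV) (lexKey_injective.ne hne.symm)) (hmax o' ⟨a, b, hoo'⟩) ho'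
      hpow hpow' hb' (hempty b')
  obtain ⟨b', hbb', hab'⟩ := exists_ne_ne_zero_of_sum_eq_zero
    (h.sum_cocircularBoundary o a) (Finset.mem_univ b) hab
  obtain ⟨-, hne, hpow, -⟩ := h.circlePower_nonneg_of_cocircularBoundary_ne_zero hab
  obtain ⟨-, hne', hpow', -⟩ := h.circlePower_nonneg_of_cocircularBoundary_ne_zero hab'
  refine orient_ne_zero_of_circlePower_eq_zero hpow hpow' hne hne' (hz.ne hbb'.symm)
    (le_antisymm ?_ (hleft hab hpow'))
  rw [← neg_nonneg, ← orient_swap_right]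
  exact hleft hab' hpow

theorem sum_cocircularPart_mul_eq_zero (h : IsDelaunayCycle z δ) (hz : Function.Injective z)
    {W : ι → ι → ι → ℝ} (hswap : ∀ a b c, W b a c = -W a b c)
    (hadd : ∀ a b c v, 0 < orient (z a) (z b) (z c) → circumpower (z a) (z b) (z c) (z v) = 0 →
      W a b c = W a b v + W b c v + W c a v) (o : ℂ) :
    ∑ a, ∑ b, ∑ c, cocircularPart z δ o a b c * W a b c = 0 := by
  by_cases hex : ∃ v v' v'', cocircularPart z δ o v v' v'' ≠ 0
  swap
  · push Not at hex
    simp [hex]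
  obtain ⟨v, v', v'', hv⟩ := hex
  obtain ⟨hδv, hov⟩ := of_cocircularPart_ne_zero hv
  have hcone (a b c : ι) : cocircularPart z δ o a b c * W a b c =
      cocircularPart z δ o a b c * (W a b v + W b c v + W c a v) := by
    by_cases h0 : cocircularPart z δ o a b c = 0
    · simp [h0]
    obtain ⟨hδ, ho⟩ := of_cocircularPart_ne_zero h0
    have hva := h.circumpower_nonneg hδ v
    have hav := h.circumpower_nonneg hδv a
    rw [hadd a b c v (h.orient_pos hδ)]
    simp only [circumpower, ho, hov, circlePower] at hva hav ⊢
    linarith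
  have hstokes := sum_mul_coboundary (cocircularPart z δ o) (h.cocircularPart_rotate o)
    (fun a b => W a b v) (fun a b => hswap a b v)
  have hboundary (a b : ι) :
      ∑ c, cocircularPart z δ o a b c - ∑ c, cocircularPart z δ o b a c = 0 :=
    h.cocircularBoundary_eq_zero hz o a b
  simp only [hboundary, zero_mul, Finset.sum_const_zero, mul_zero] at hstokes
  simpa [hcone] using hstokes

theorem sum_mul_eq_zero (h : IsDelaunayCycle z δ) (hz : Function.Injective z)
    {W : ι → ι → ι → ℝ} (hswap : ∀ a b c, W b a c = -W a b c)
    (hadd : ∀ a b c v, 0 < orient (z a) (z b) (z c) → circumpower (z a) (z b) (z c) (z v) = 0 →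
      W a b c = W a b v + W b c v + W c a v) :
    ∑ a, ∑ b, ∑ c, δ a b c * W a b c = 0 := by
  calc ∑ a, ∑ b, ∑ c, δ a b c * W a b c
      = ∑ a, ∑ b, ∑ c, ∑ o ∈ circumcenters z, cocircularPart z δ o a b c * W a b c := by
        simp only [← Finset.sum_mul, sum_cocircularPart]
    _ = ∑ o ∈ circumcenters z, ∑ a, ∑ b, ∑ c, cocircularPart z δ o a b c * W a b c := by
        simp only [Finset.sum_comm (t := circumcenters z)]
    _ = 0 := Finset.sum_eq_zero fun o _ => h.sum_cocircularPart_mul_eq_zero hz hswap hadd o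

end IsDelaunayCycle

namespace IsFilling

variable {B : ι → ι → ℤ} {m m' : ι → ι → ι → ℤ}

theorem isDelaunayCycle_sub (h : IsFilling z B m) (h' : IsFilling z B m')
    (hm : ∀ a b c, m a b c ≠ 0 → ∀ w, 0 ≤ circumpower (z a) (z b) (z c) (z w))
    (hm' : ∀ a b c, m' a b c ≠ 0 → ∀ w, 0 ≤ circumpower (z a) (z b) (z c) (z w)) :
    IsDelaunayCycle z fun a b c => (m a b c : ℝ) - m' a b c := by
  have hsupp {a b c : ι} (hne : (m a b c : ℝ) - m' a b c ≠ 0) : m a b c ≠ 0 ∨ m' a b c ≠ 0 := by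
    by_contra! hzero
    simp [hzero] at hne
  refine ⟨fun a b c => by rw [h.rotate, h'.rotate],
    fun hne => (hsupp hne).elim h.orient_pos h'.orient_pos,
    fun hne => (hsupp hne).elim (hm _ _ _) (hm' _ _ _), fun a b => ?_⟩
  have hB := (h.boundary a b).trans (h'.boundary a b).symm
  rw [sub_eq_sub_iff_sub_eq_sub] at hB
  simp only [Finset.sum_sub_distrib]
  exact_mod_cast hB

theorem circumpower_nonneg_of_isMaxOn (h : IsFilling z B m) {W : ι → ι → ι → ℝ}
    (hmax : ∀ m', IsFilling z B m' →
      ∑ a, ∑ b, ∑ c, (m' a b c : ℝ) * W a b c ≤ ∑ a, ∑ b, ∑ c, (m a b c : ℝ) * W a b c)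
    (hrot : ∀ a b c, W b c a = W a b c)
    (hflip : ∀ a b c d, 0 < orient (z a) (z b) (z c) → 0 < orient (z b) (z a) (z d) →
      circumpower (z a) (z b) (z c) (z d) < 0 → W a b c + W b a d < W a d c + W d b c)
    {d : ι} (habc : m a b c ≠ 0) (hbad : m b a d ≠ 0) :
    0 ≤ circumpower (z a) (z b) (z c) (z d) := by
  classical
  by_contra! hneg
  have hd : orient (z a) (z b) (z d) < 0 := by
    simpa only [orient_swap_left (z a), neg_pos] using h.orient_pos hbad
  obtain ⟨hbcd, hcad⟩ := orient_pos_of_circumpower_nonpos (h.orient_pos habc) hd hneg.le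
  have hle := hmax _ (h.isFilling_flip habc hbad (by rwa [← orient_rotate (z c)] at hcad)
    (by rwa [orient_rotate] at hbcd))
  rw [sum_flip_mul _ _ _ _ _ W hrot] at hle
  linarith [hflip a b c d (h.orient_pos habc) (h.orient_pos hbad) hneg]

theorem sum_mul_le_of_circumpower_nonneg (h : IsFilling z B m) (h' : IsFilling z B m')
    (hz : Function.Injective z) (hB : ∀ a b, 0 < B a b → ∀ v, 0 ≤ orient (z a) (z b) (z v))
    (hm' : ∀ a b c, m' a b c ≠ 0 → ∀ w, 0 ≤ circumpower (z a) (z b) (z c) (z w))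
    {W : ι → ι → ι → ℝ} (hrot : ∀ a b c, W b c a = W a b c) (hswap : ∀ a b c, W b a c = -W a b c)
    (hadd : ∀ a b c v, 0 < orient (z a) (z b) (z c) → circumpower (z a) (z b) (z c) (z v) = 0 →
      W a b c = W a b v + W b c v + W c a v)
    (hflip : ∀ a b c d, 0 < orient (z a) (z b) (z c) → 0 < orient (z b) (z a) (z d) →
      circumpower (z a) (z b) (z c) (z d) < 0 → W a b c + W b a d < W a d c + W d b c) :
    ∑ a, ∑ b, ∑ c, (m a b c : ℝ) * W a b c ≤ ∑ a, ∑ b, ∑ c, (m' a b c : ℝ) * W a b c := by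
  obtain ⟨n, hn, hmax⟩ := Set.exists_max_image {m | IsFilling z B m}
    (fun m => ∑ a, ∑ b, ∑ c, (m a b c : ℝ) * W a b c) (finite_setOf z B) ⟨m, h⟩
  have hn' (a b c : ι) (hne : n a b c ≠ 0) (w : ι) : 0 ≤ circumpower (z a) (z b) (z c) (z w) :=
    hn.circumpower_nonneg_of_local hB
      (fun _ _ _ _ => hn.circumpower_nonneg_of_isMaxOn hmax hrot hflip) hne w
  have hzero := (hn.isDelaunayCycle_sub h' hn' hm').sum_mul_eq_zero hz hswap hadd
  simp only [sub_mul, Finset.sum_sub_distrib, sub_eq_zero] at hzero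
  exact (hmax m h).trans_eq hzero

end IsFilling

end DelaunayCycle

section FaceForm

/-- The second divided difference at `p, q, r` of a function taking the values `x, y, w` there. -/
noncomputable def secondDivDiff (p q r x y w : ℂ) : ℂ :=
  x / ((p - q) * (p - r)) + y / ((q - p) * (q - r)) + w / ((r - p) * (r - q))

/-- The third divided difference at `p, q, r, s` of a function taking the values `x, y, w, u`
there. -/
noncomputable def thirdDivDiff (p q r s x y w u : ℂ) : ℂ :=
  x / ((p - q) * (p - r) * (p - s)) + y / ((q - p) * (q - r) * (q - s)) +
    w / ((r - p) * (r - q) * (r - s)) + u / ((s - p) * (s - q) * (s - r))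

theorem secondDivDiff_rotate (p q r x y w : ℂ) :
    secondDivDiff q r p y w x = secondDivDiff p q r x y w := by
  simp only [secondDivDiff]
  ring

theorem secondDivDiff_swap (p q r x y w : ℂ) :
    secondDivDiff q p r y x w = secondDivDiff p q r x y w := by
  simp only [secondDivDiff]
  ring

theorem thirdDivDiff_rotate (p q r s x y w u : ℂ) :
    thirdDivDiff q r p s y w x u = thirdDivDiff p q r s x y w u := by
  simp only [thirdDivDiff]
  ring

theorem thirdDivDiff_cube {p q r s : ℂ} (hpq : p ≠ q) (hpr : p ≠ r) (hps : p ≠ s) (hqr : q ≠ r)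
    (hqs : q ≠ s) (hrs : r ≠ s) :
    thirdDivDiff p q r s (p ^ 3) (q ^ 3) (r ^ 3) (s ^ 3) = 1 := by
  have hpq' := sub_ne_zero.mpr hpq.symm
  have hpr' := sub_ne_zero.mpr hpr.symm
  have hps' := sub_ne_zero.mpr hps.symm
  have hqr' := sub_ne_zero.mpr hqr.symm
  have hqs' := sub_ne_zero.mpr hqs.symm
  have hrs' := sub_ne_zero.mpr hrs.symm
  rw [← sub_ne_zero] at hpq hpr hps hqr hqs hrs
  simp only [thirdDivDiff]
  field_simp
  ring

theorem secondDivDiff_eq_sub_thirdDivDiff_mul {p q r s : ℂ} (hpq : p ≠ q) (hpr : p ≠ r)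
    (hps : p ≠ s) (hqr : q ≠ r) (hqs : q ≠ s) (hrs : r ≠ s) (x y w u : ℂ) :
    secondDivDiff p q s x y u =
      secondDivDiff p q r x y w - thirdDivDiff p q r s x y w u * (r - s) := by
  have hpq' := sub_ne_zero.mpr hpq.symm
  have hpr' := sub_ne_zero.mpr hpr.symm
  have hps' := sub_ne_zero.mpr hps.symm
  have hqr' := sub_ne_zero.mpr hqr.symm
  have hqs' := sub_ne_zero.mpr hqs.symm
  have hrs' := sub_ne_zero.mpr hrs.symm
  rw [← sub_ne_zero] at hpq hpr hps hqr hqs hrs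
  simp only [secondDivDiff, thirdDivDiff]
  field_simp
  ring

theorem orient_mul_normSq_coboundary {o a b c d : ℂ} (G k : ℂ) (hb : circlePower o a b = 0)
    (hc : circlePower o a c = 0) :
    orient a b d * Complex.normSq (G - k * (c - d)) +
        orient b c d * Complex.normSq (G - k * (a - d)) +
        orient c a d * Complex.normSq (G - k * (b - d)) - orient a b c * Complex.normSq G =
      -(Complex.normSq k * (orient a b c * circlePower o a d)) := by
  simp only [circlePower, orient, Complex.normSq_apply, Complex.sub_re, Complex.sub_im,
    Complex.mul_re, Complex.mul_im] at *
  linear_combination (k.re * k.re + k.im * k.im) *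
    (((a.re - c.re) * (d.im - c.im) - (a.im - c.im) * (d.re - c.re)) * hb +
      ((b.re - a.re) * (d.im - a.im) - (b.im - a.im) * (d.re - a.re)) * hc)

variable {ι : Type*} {z φ : ι → ℂ} {a b c d v : ι}

/-- The contribution of the triangle `a b c` to the quadratic form of second divided differences
of `φ`. -/
noncomputable def faceForm (z φ : ι → ℂ) (a b c : ι) : ℝ :=
  orient (z a) (z b) (z c) / 2 *
    Complex.normSq (secondDivDiff (z a) (z b) (z c) (φ a) (φ b) (φ c))

variable (z φ) in
theorem faceForm_rotate (a b c : ι) : faceForm z φ b c a = faceForm z φ a b c := by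
  simp only [faceForm, orient_rotate, secondDivDiff_rotate]

variable (z φ) in
theorem faceForm_swap (a b c : ι) : faceForm z φ b a c = -faceForm z φ a b c := by
  simp only [faceForm, orient_swap_left (z a), secondDivDiff_swap]
  ring

variable (z φ) in
theorem faceForm_self (a b : ι) : faceForm z φ a a b = 0 := by simp [faceForm]

variable (φ) in
theorem faceForm_coboundary (hz : Function.Injective z) (h : orient (z a) (z b) (z c) ≠ 0)
    (v : ι) :
    faceForm z φ a b v + faceForm z φ b c v + faceForm z φ c a v - faceForm z φ a b c =
      -(Complex.normSq (thirdDivDiff (z a) (z b) (z c) (z v) (φ a) (φ b) (φ c) (φ v)) / 2) *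
        (orient (z a) (z b) (z c) * circumpower (z a) (z b) (z c) (z v)) := by
  have hself (x y : ι) : faceForm z φ x y y = 0 := by
    rw [← faceForm_rotate z φ x y y, faceForm_self]
  have hself' (x y : ι) : faceForm z φ x y x = 0 := by rw [faceForm_rotate, faceForm_self]
  rcases eq_or_ne v a with rfl | hav
  · simp [hself, hself', faceForm_rotate z φ v b c, circumpower_fst]
  rcases eq_or_ne v b with rfl | hbv
  · simp [hself, hself', faceForm_rotate z φ c a v, circumpower_snd h]
  rcases eq_or_ne v c with rfl | hcv
  · simp [hself, hself', circumpower_thd h]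
  obtain ⟨hab, hbc, hca⟩ := ne_of_orient_ne_zero h
  rw [← hz.ne_iff] at hav hbv hcv
  have habv := secondDivDiff_eq_sub_thirdDivDiff_mul hab hca.symm hav.symm hbc hbv.symm hcv.symm
    (φ a) (φ b) (φ c) (φ v)
  have hbcv := secondDivDiff_eq_sub_thirdDivDiff_mul hbc hab.symm hbv.symm hca hcv.symm hav.symm
    (φ b) (φ c) (φ a) (φ v)
  have hcav := secondDivDiff_eq_sub_thirdDivDiff_mul hca hbc.symm hcv.symm hab hav.symm hbv.symm
    (φ c) (φ a) (φ b) (φ v)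
  rw [thirdDivDiff_rotate, secondDivDiff_rotate (z a) (z b) (z c)] at hbcv
  rw [thirdDivDiff_rotate, thirdDivDiff_rotate, secondDivDiff_rotate (z b) (z c) (z a),
    secondDivDiff_rotate (z a) (z b) (z c)] at hcav
  have hquad := orient_mul_normSq_coboundary (d := z v)
    (secondDivDiff (z a) (z b) (z c) (φ a) (φ b) (φ c))
    (thirdDivDiff (z a) (z b) (z c) (z v) (φ a) (φ b) (φ c) (φ v))
    (circumpower_snd h) (circumpower_thd h)
  simp only [faceForm, habv, hbcv, hcav, circumpower]
  linarith

theorem faceForm_eq_add_of_circumpower_eq_zero (hz : Function.Injective z)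
    (h : orient (z a) (z b) (z c) ≠ 0) (hv : circumpower (z a) (z b) (z c) (z v) = 0) :
    faceForm z φ a b c = faceForm z φ a b v + faceForm z φ b c v + faceForm z φ c a v := by
  have hcob := faceForm_coboundary φ hz h v
  rw [hv, mul_zero, mul_zero, sub_eq_zero] at hcob
  exact hcob.symm

theorem faceForm_add_faceForm_eq (hz : Function.Injective z) (h : orient (z a) (z b) (z c) ≠ 0)
    (d : ι) :
    faceForm z φ a b c + faceForm z φ b a d = faceForm z φ a d c + faceForm z φ d b c +
      Complex.normSq (thirdDivDiff (z a) (z b) (z c) (z d) (φ a) (φ b) (φ c) (φ d)) / 2 *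
        (orient (z a) (z b) (z c) * circumpower (z a) (z b) (z c) (z d)) := by
  rw [faceForm_swap z φ a b d, ← faceForm_rotate z φ d b c, faceForm_rotate z φ c a d]
  linarith [faceForm_coboundary φ hz h d]

theorem faceForm_flip_le (hz : Function.Injective z) (h : 0 < orient (z a) (z b) (z c))
    (hd : circumpower (z a) (z b) (z c) (z d) < 0) :
    faceForm z φ a b c + faceForm z φ b a d ≤ faceForm z φ a d c + faceForm z φ d b c := by
  rw [faceForm_add_faceForm_eq hz h.ne', add_le_iff_nonpos_right]
  exact mul_nonpos_of_nonneg_of_nonpos (div_nonneg (Complex.normSq_nonneg _) zero_le_two)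
    (mul_neg_of_pos_of_neg h hd).le

theorem faceForm_cube_flip_lt (hz : Function.Injective z) (h : 0 < orient (z a) (z b) (z c))
    (hd : circumpower (z a) (z b) (z c) (z d) < 0) :
    faceForm z (z ^ 3) a b c + faceForm z (z ^ 3) b a d <
      faceForm z (z ^ 3) a d c + faceForm z (z ^ 3) d b c := by
  obtain ⟨hab, hbc, hca⟩ := ne_of_orient_ne_zero h.ne'
  have hne (w : ℂ) (hw : circumpower (z a) (z b) (z c) w = 0) : w ≠ z d := by
    rintro rfl
    exact hd.ne hw
  have hneg := mul_neg_of_pos_of_neg h hd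
  rw [faceForm_add_faceForm_eq hz h.ne', add_lt_iff_neg_left]
  simp only [Pi.pow_apply]
  rw [thirdDivDiff_cube hab hca.symm (hne _ (circumpower_fst _ _ _)) hbc
    (hne _ (circumpower_snd h.ne')) (hne _ (circumpower_thd h.ne')), map_one]
  linarith

theorem le_of_forall_pos_add_mul_le {x y x' y' : ℝ}
    (h : ∀ ε > 0, x + ε * y ≤ x' + ε * y') : x ≤ x' := by
  have htendsto (s t : ℝ) :
      Filter.Tendsto (fun ε => s + ε * t) (nhdsWithin 0 (Set.Ioi 0)) (nhds s) := by
    refine (Continuous.tendsto' ?_ 0 s (by simp)).mono_left nhdsWithin_le_nhds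
    fun_prop
  exact le_of_tendsto_of_tendsto (htendsto x y) (htendsto x' y')
    (Filter.eventually_of_mem self_mem_nhdsWithin h)

variable (φ) in
/-- Flips need not increase `faceForm z φ` strictly, but they do after adding a small multiple of
`faceForm z (z ^ 3)`, since the third divided differences of the cubes are `1`. -/
theorem IsFilling.sum_faceForm_le [Fintype ι] {B : ι → ι → ℤ} {m m' : ι → ι → ι → ℤ}
    (h : IsFilling z B m) (h' : IsFilling z B m') (hz : Function.Injective z)
    (hB : ∀ a b, 0 < B a b → ∀ v, 0 ≤ orient (z a) (z b) (z v))
    (hm' : ∀ a b c, m' a b c ≠ 0 → ∀ w, 0 ≤ circumpower (z a) (z b) (z c) (z w)) :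
    ∑ a, ∑ b, ∑ c, (m a b c : ℝ) * faceForm z φ a b c ≤
      ∑ a, ∑ b, ∑ c, (m' a b c : ℝ) * faceForm z φ a b c := by
  refine le_of_forall_pos_add_mul_le
    (y := ∑ a, ∑ b, ∑ c, (m a b c : ℝ) * faceForm z (z ^ 3) a b c)
    (y' := ∑ a, ∑ b, ∑ c, (m' a b c : ℝ) * faceForm z (z ^ 3) a b c) fun ε hε => ?_
  have hle := h.sum_mul_le_of_circumpower_nonneg h' hz hB hm'
    (W := fun a b c => faceForm z φ a b c + ε * faceForm z (z ^ 3) a b c)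
    (fun a b c => by simp only [faceForm_rotate])
    (fun a b c => by simp only [faceForm_swap z _ a b, mul_neg, neg_add])
    (fun a b c v habc hv => by
      rw [faceForm_eq_add_of_circumpower_eq_zero (φ := φ) hz habc.ne' hv,
        faceForm_eq_add_of_circumpower_eq_zero (φ := z ^ 3) hz habc.ne' hv]
      ring)
    (fun a b c d habc _ hd => by
      have hφ := faceForm_flip_le (φ := φ) hz habc hd
      have hcube := mul_lt_mul_of_pos_left (faceForm_cube_flip_lt hz habc hd) hε
      linarith)
  simpa only [mul_add, Finset.sum_add_distrib, Finset.mul_sum, mul_left_comm ε] using hle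

end FaceForm

section ConvexPlane

variable {a b c w : ℂ} {S : Set ℂ}

theorem orient_smul_add_smul (a b x y : ℂ) {s t : ℝ} (hst : s + t = 1) :
    orient a b (s • x + t • y) = s * orient a b x + t * orient a b y := by
  obtain rfl : s = 1 - t := by linarith
  simp only [orient, Complex.add_re, Complex.add_im, Complex.real_smul, Complex.mul_re,
    Complex.mul_im, Complex.ofReal_re, Complex.ofReal_im]
  ring

theorem orient_lineMap (a b x y : ℂ) (t : ℝ) :
    orient a b (AffineMap.lineMap x y t) = (1 - t) * orient a b x + t * orient a b y := by
  rw [AffineMap.lineMap_apply_module, orient_smul_add_smul a b x y (by ring)]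

theorem orient_midpoint (a b x y : ℂ) :
    orient a b (midpoint ℝ x y) = (orient a b x + orient a b y) / 2 := by
  rw [midpoint, orient_lineMap, invOf_eq_inv]
  ring

theorem convex_setOf_orient_nonneg (a b : ℂ) : Convex ℝ {w | 0 ≤ orient a b w} := by
  intro x hx y hy s t hs ht hst
  rw [Set.mem_ofPred_eq] at *
  rw [orient_smul_add_smul a b x y hst]
  positivity

theorem orient_nonneg_of_mem_convexHull (hS : ∀ x ∈ S, 0 ≤ orient a b x)
    (hw : w ∈ convexHull ℝ S) : 0 ≤ orient a b w :=
  convexHull_min hS (convex_setOf_orient_nonneg a b) hw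

theorem orient_eq_zero_of_mem_convexHull (hS : ∀ x ∈ S, orient a b x = 0)
    (hw : w ∈ convexHull ℝ S) : orient a b w = 0 := by
  refine le_antisymm ?_ (orient_nonneg_of_mem_convexHull (fun x hx => (hS x hx).ge) hw)
  rw [← neg_nonneg, ← orient_swap_left]
  exact orient_nonneg_of_mem_convexHull (fun x hx => by rw [orient_swap_left, hS x hx, neg_zero]) hw

theorem orient_smul_eq (a b c w : ℂ) :
    orient a b c • w = orient b c w • a + orient c a w • b + orient a b w • c := by
  apply Complex.ext <;> simp [orient] <;> ring

theorem mem_convexHull_triple_iff (h : 0 < orient a b c) :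
    w ∈ convexHull ℝ {a, b, c} ↔
      0 ≤ orient a b w ∧ 0 ≤ orient b c w ∧ 0 ≤ orient c a w := by
  have h' : 0 < orient b c a := by rwa [orient_rotate]
  have h'' : 0 < orient c a b := by rwa [orient_rotate]
  refine ⟨fun hw => ⟨?_, ?_, ?_⟩, fun ⟨hab, hbc, hca⟩ => ?_⟩
  · refine orient_nonneg_of_mem_convexHull ?_ hw
    simp [h.le]
  · refine orient_nonneg_of_mem_convexHull ?_ hw
    simp [h'.le]
  · refine orient_nonneg_of_mem_convexHull ?_ hw
    simp [h''.le]
  · rw [← inv_smul_smul₀ h.ne' w, orient_smul_eq, smul_add, smul_add, smul_smul, smul_smul,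
      smul_smul]
    have hsum : (orient a b c)⁻¹ * orient b c w + (orient a b c)⁻¹ * orient c a w +
        (orient a b c)⁻¹ * orient a b w = 1 := by
      rw [← mul_add, ← mul_add, orient_add_orient_add_orient, inv_mul_cancel₀ h.ne']
    have hmem := (convex_convexHull ℝ {a, b, c}).sum_mem (t := Finset.univ) (w := ![
      (orient a b c)⁻¹ * orient b c w, (orient a b c)⁻¹ * orient c a w,
      (orient a b c)⁻¹ * orient a b w]) (z := ![a, b, c]) ?_ ?_ ?_
    · simpa only [Fin.sum_univ_three, Matrix.cons_val] using hmem
    · simp only [Fin.forall_fin_succ, Matrix.cons_val]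
      have hinv := inv_nonneg.mpr h.le
      simp [mul_nonneg hinv, hab, hbc, hca]
    · simpa only [Fin.sum_univ_three, Matrix.cons_val] using hsum
    · refine fun i _ => subset_convexHull ℝ _ ?_
      fin_cases i <;> simp

theorem mem_convexHull_setOf_orient_eq_zero (hS : ∀ x ∈ S, 0 ≤ orient a b x)
    (hw : w ∈ convexHull ℝ S) (h : orient a b w = 0) :
    w ∈ convexHull ℝ {x ∈ S | orient a b x = 0} := by
  set K := convexHull ℝ {x ∈ S | orient a b x = 0}
  have hK (x : ℂ) (hx : x ∈ K) : orient a b x = 0 :=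
    orient_eq_zero_of_mem_convexHull (fun _ hy => hy.2) hx
  have hconvex : Convex ℝ {x | 0 < orient a b x ∨ x ∈ K} := by
    refine convex_iff_forall_pos.mpr fun x hx y hy s t hs ht hst => ?_
    simp only [Set.mem_ofPred_eq, orient_smul_add_smul a b x y hst] at hx hy ⊢
    rcases hx with hx | hx <;> rcases hy with hy | hy
    · exact Or.inl (by positivity)
    · exact Or.inl (by rw [hK y hy]; positivity)
    · exact Or.inl (by rw [hK x hx]; positivity)
    · exact Or.inr (convex_convexHull ℝ _ hx hy hs.le ht.le hst)
  refine (convexHull_min (fun x hx => ?_) hconvex hw).resolve_left h.not_gt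
  exact (hS x hx).lt_or_eq.imp_right fun hx0 => subset_convexHull ℝ _ ⟨hx, hx0.symm⟩

theorem endpoints_mem_convexHull_of_midpoint_mem (hab : a ≠ b) (hS : ∀ x ∈ S, 0 ≤ orient a b x)
    (hopen : ∀ t ∈ Set.Ioo (0 : ℝ) 1, AffineMap.lineMap a b t ∉ S)
    (hmid : midpoint ℝ a b ∈ convexHull ℝ S) : a ∈ convexHull ℝ S ∧ b ∈ convexHull ℝ S := by
  set R : Set ℝ := {t | AffineMap.lineMap a b t ∈ S}
  have hhalf : (1 / 2 : ℝ) ∈ convexHull ℝ R := by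
    have hmem := mem_convexHull_setOf_orient_eq_zero hS hmid (by simp [orient_midpoint])
    have hsub : {x ∈ S | orient a b x = 0} ⊆ AffineMap.lineMap a b '' R := by
      rintro x ⟨hx, hx0⟩
      obtain ⟨t, rfl⟩ := exists_lineMap_eq_of_orient_eq_zero hab hx0
      exact ⟨t, hx, rfl⟩
    have himage := convexHull_mono hsub hmem
    rw [← AffineMap.image_convexHull] at himage
    obtain ⟨t, ht, htmid⟩ := himage
    rw [midpoint, invOf_eq_inv, (AffineMap.lineMap_injective ℝ hab).eq_iff] at htmid
    rwa [one_div, ← htmid]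
  have hR (t : ℝ) (ht : t ∈ R) : t ≤ 0 ∨ 1 ≤ t := by
    by_contra! hcon
    exact hopen t hcon ht
  obtain ⟨s, hsR, hs⟩ : ∃ s ∈ R, s ≤ 0 := by
    by_contra! hcon
    have : (1 : ℝ) ≤ 1 / 2 := convexHull_min (s := R) (t := Set.Ici 1)
      (fun t ht => (hR t ht).resolve_left (hcon t ht).not_ge) (convex_Ici 1) hhalf
    norm_num at this
  obtain ⟨t, htR, ht⟩ : ∃ t ∈ R, 1 ≤ t := by
    by_contra! hcon
    have : (1 / 2 : ℝ) ≤ 0 := convexHull_min (s := R) (t := Set.Iic 0)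
      (fun t ht => (hR t ht).resolve_right (hcon t ht).not_ge) (convex_Iic 0) hhalf
    norm_num at this
  have hsegment : AffineMap.lineMap a b '' Set.Icc s t ⊆ convexHull ℝ S := by
    rw [← segment_eq_Icc (hs.trans (zero_le_one.trans ht)), image_segment]
    exact segment_subset_convexHull hsR htR
  exact ⟨hsegment ⟨0, ⟨hs, by linarith⟩, AffineMap.lineMap_apply_zero a b⟩,
    hsegment ⟨1, ⟨by linarith, ht⟩, AffineMap.lineMap_apply_one a b⟩⟩

theorem eventually_lineMap_midpoint_mem_convexHull (h : 0 < orient a b c) (hw : 0 < orient a b w) :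
    ∀ᶠ t in nhdsWithin (0 : ℝ) (Set.Ioi 0),
      AffineMap.lineMap (midpoint ℝ a b) w t ∈ convexHull ℝ {a, b, c} := by
  have hpos (p q : ℂ) (hpq : 0 < orient p q (midpoint ℝ a b)) :
      ∀ᶠ t in nhdsWithin (0 : ℝ) (Set.Ioi 0),
        0 < orient p q (AffineMap.lineMap (midpoint ℝ a b) w t) := by
    simp only [orient_lineMap]
    refine nhdsWithin_le_nhds (ContinuousAt.eventually_mem (by fun_prop) (Ioi_mem_nhds ?_))
    simpa using hpq
  have hbc : 0 < orient b c (midpoint ℝ a b) := by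
    simp [orient_midpoint, orient_rotate, h]
  have hca : 0 < orient c a (midpoint ℝ a b) := by
    simp [orient_midpoint, orient_rotate b c a, orient_rotate, h]
  filter_upwards [hpos b c hbc, hpos c a hca, self_mem_nhdsWithin] with t htbc htca ht
  rw [mem_convexHull_triple_iff h]
  refine ⟨?_, htbc.le, htca.le⟩
  simp only [orient_lineMap, orient_midpoint, orient_self_outer, orient_self_right]
  have := mul_pos ht hw
  linarith

end ConvexPlane

section Triangulations

variable {ι : Type*} {z : ι → ℂ} {a b c d v w : ι}

theorem IsEmptyTriangle.lineMap_ne (h : IsEmptyTriangle z a b c) {t : ℝ} (ht : t ∈ Set.Ioo 0 1)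
    (v : ι) : AffineMap.lineMap (z a) (z b) t ≠ z v := by
  intro heq
  have habc := h.orient_pos
  have hab : orient (z a) (z b) (z v) = 0 := by simp [← heq, orient_lineMap]
  have hbc : 0 < orient (z b) (z c) (z v) := by
    rw [← heq, orient_lineMap, orient_self_outer, orient_rotate, mul_zero, add_zero]
    exact mul_pos (sub_pos.mpr ht.2) habc
  have hca : 0 < orient (z c) (z a) (z v) := by
    rw [← heq, orient_lineMap, orient_self_right, orient_rotate, orient_rotate, mul_zero, zero_add]
    exact mul_pos ht.1 habc
  rcases h.eq_or_eq_or_eq v hab.ge hbc.le hca.le with rfl | rfl | rfl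
  · simp at hca
  · simp at hbc
  · exact habc.ne' hab

namespace PointTriangulation

theorem mem_of_mem_convexHull (T : PointTriangulation z) {f : Finset ι} (hf : f ∈ T.faces)
    (hv : z v ∈ convexHull ℝ (z '' (f : Set ι))) : v ∈ f := by
  obtain ⟨g, hg, hvg⟩ := T.exists_face v
  have hinter : z v ∈ convexHull ℝ (z '' ((f : Set ι) ∩ (g : Set ι))) := by
    rw [← T.inter_face f hf g hg]
    exact ⟨hv, subset_convexHull ℝ _ (Set.mem_image_of_mem z hvg)⟩
  have himage : z '' ((f : Set ι) ∩ (g : Set ι)) = (fun x : g => z x) '' {x : g | (x : ι) ∈ f} := by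
    ext p
    simp only [Set.mem_image, Set.mem_inter_iff, Finset.mem_coe, Set.mem_ofPred_eq, Subtype.exists]
    grind
  rw [himage] at hinter
  exact ((T.affineIndependent_face g hg).mem_affineSpan_iff ⟨v, hvg⟩ {x : g | (x : ι) ∈ f}).mp
    (convexHull_subset_affineSpan _ hinter)

theorem finite (T : PointTriangulation z) : Finite ι :=
  Set.finite_univ_iff.mp <| (T.faces.finite_toSet.biUnion fun f _ => f.finite_toSet).subset
    fun v _ => by simpa using T.exists_face v

theorem injective (T : PointTriangulation z) : Function.Injective z := by
  intro v w hvw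
  obtain ⟨g, hg, hwg⟩ := T.exists_face w
  have hvg : v ∈ g := T.mem_of_mem_convexHull hg <|
    hvw ▸ subset_convexHull ℝ _ (Set.mem_image_of_mem z hwg)
  exact congrArg Subtype.val
    ((T.affineIndependent_face g hg).injective (a₁ := ⟨v, hvg⟩) (a₂ := ⟨w, hwg⟩) hvw)

theorem exists_mem_convexHull_and_lineMap_mem (T : PointTriangulation z) {x y : ℂ}
    (hx : x ∈ convexHull ℝ (Set.range z)) (hy : y ∈ convexHull ℝ (Set.range z)) :
    ∃ f ∈ T.faces, x ∈ convexHull ℝ (z '' (f : Set ι)) ∧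
      ∃ t > (0 : ℝ), AffineMap.lineMap x y t ∈ convexHull ℝ (z '' (f : Set ι)) := by
  have hcover : ∀ᶠ t : ℝ in nhdsWithin 0 (Set.Ioi 0), ∃ f ∈ T.faces,
      AffineMap.lineMap x y t ∈ convexHull ℝ (z '' (f : Set ι)) := by
    filter_upwards [Ioo_mem_nhdsGT zero_lt_one] with t ht
    have hmem := (convex_convexHull ℝ (Set.range z)).lineMap_mem hx hy ⟨ht.1.le, ht.2.le⟩
    simpa only [← T.iUnion_face, Set.mem_iUnion, exists_prop] using hmem
  obtain ⟨f, hf, hfreq⟩ := (Filter.frequently_exists_finset _).mp hcover.frequently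
  have hclosed : IsClosed (convexHull ℝ (z '' (f : Set ι))) :=
    ((f.finite_toSet.image z).isCompact_convexHull ℝ).isClosed
  have htendsto : Filter.Tendsto (fun t : ℝ => (AffineMap.lineMap x y t : ℂ))
      (nhdsWithin 0 (Set.Ioi 0)) (nhds x) :=
    ((AffineMap.lineMap_continuous (R := ℝ)).tendsto' 0 x (by simp)).mono_left nhdsWithin_le_nhds
  obtain ⟨t, htmem, ht⟩ := (hfreq.and_eventually self_mem_nhdsWithin).exists
  exact ⟨f, hf, hclosed.mem_of_frequently_of_tendsto hfreq htendsto, t, ht, htmem⟩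

theorem mem_and_mem_of_midpoint_mem (T : PointTriangulation z) (h : IsEmptyTriangle z a b c)
    {g : Finset ι} (hg : g ∈ T.faces) {s : Set ι} (hsg : s ⊆ g)
    (hs : ∀ v ∈ s, 0 ≤ orient (z a) (z b) (z v))
    (hmid : midpoint ℝ (z a) (z b) ∈ convexHull ℝ (z '' s)) : a ∈ g ∧ b ∈ g := by
  have hopen (t : ℝ) (ht : t ∈ Set.Ioo 0 1) : AffineMap.lineMap (z a) (z b) t ∉ z '' s := by
    rintro ⟨v, -, hv⟩
    exact h.lineMap_ne ht v hv.symm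
  have hmono : convexHull ℝ (z '' s) ⊆ convexHull ℝ (z '' (g : Set ι)) :=
    convexHull_mono (Set.image_mono hsg)
  exact (endpoints_mem_convexHull_of_midpoint_mem (ne_of_orient_ne_zero h.orient_pos.ne').1
    (Set.forall_mem_image.mpr hs) hopen hmid).imp (fun ha => T.mem_of_mem_convexHull hg (hmono ha))
    (fun hb => T.mem_of_mem_convexHull hg (hmono hb))

variable [DecidableEq ι]

theorem exists_eq_insert_pair (T : PointTriangulation z) {g : Finset ι} (hg : g ∈ T.faces)
    (hab : a ≠ b) (ha : a ∈ g) (hb : b ∈ g) :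
    ∃ d, g = {a, b, d} ∧ orient (z a) (z b) (z d) ≠ 0 := by
  obtain ⟨d, hd, hdab⟩ := Finset.exists_mem_notMem_of_card_lt_card
    (s := {a, b}) (t := g) (by rw [T.card_face g hg, Finset.card_pair hab]; norm_num)
  simp only [Finset.mem_insert, Finset.mem_singleton, not_or] at hdab
  refine ⟨d, (Finset.eq_of_subset_of_card_le ?_ ?_).symm, ?_⟩
  · simp [Finset.insert_subset_iff, ha, hb, hd]
  · rw [T.card_face g hg,
      Finset.card_eq_three.mpr ⟨a, b, d, hab, Ne.symm hdab.1, Ne.symm hdab.2, rfl⟩]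
  · refine orient_ne_zero_of_affineIndependent ?_
    have hinj : Function.Injective ![(⟨a, ha⟩ : g), ⟨b, hb⟩, ⟨d, hd⟩] := by
      simp [Function.Injective, Fin.forall_fin_succ, hab, hab.symm, hdab, Ne.symm hdab.1,
        Ne.symm hdab.2]
    convert (T.affineIndependent_face g hg).comp_embedding ⟨_, hinj⟩ using 1
    ext i
    fin_cases i <;> rfl

theorem exists_orient_pos (T : PointTriangulation z) {f : Finset ι} (hf : f ∈ T.faces) :
    ∃ a b c, f = {a, b, c} ∧ 0 < orient (z a) (z b) (z c) := by
  obtain ⟨a, ha, b, hb, hab⟩ := Finset.one_lt_card.mp (by rw [T.card_face f hf]; norm_num)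
  obtain ⟨c, rfl, hc⟩ := T.exists_eq_insert_pair hf hab ha hb
  rcases hc.lt_or_gt with hneg | hpos
  · exact ⟨b, a, c, Finset.insert_comm a b {c}, by rwa [orient_swap_left, neg_pos]⟩
  · exact ⟨a, b, c, rfl, hpos⟩

/-- The indicator function of the positively oriented faces of a triangulation, each counted with
its three cyclic orderings. -/
noncomputable def faceChain (T : PointTriangulation z) (a b c : ι) : ℤ :=
  if {a, b, c} ∈ T.faces ∧ 0 < orient (z a) (z b) (z c) then 1 else 0

theorem faceChain_ne_zero {T : PointTriangulation z} :
    T.faceChain a b c ≠ 0 ↔ {a, b, c} ∈ T.faces ∧ 0 < orient (z a) (z b) (z c) := by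
  simp [faceChain]

theorem faceChain_rotate (T : PointTriangulation z) (a b c : ι) :
    T.faceChain b c a = T.faceChain a b c := by
  simp only [faceChain, orient_rotate]
  rw [show ({b, c, a} : Finset ι) = {a, b, c} by grind]

theorem coe_image_insert_pair (z : ι → ℂ) (a b c : ι) :
    z '' (({a, b, c} : Finset ι) : Set ι) = {z a, z b, z c} := by
  simp [Set.image_insert_eq]

theorem isEmptyTriangle_of_faceChain_ne_zero (T : PointTriangulation z)
    (h : T.faceChain a b c ≠ 0) : IsEmptyTriangle z a b c where
  orient_pos := (faceChain_ne_zero.mp h).2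
  eq_or_eq_or_eq v hab hbc hca := by
    obtain ⟨hf, hpos⟩ := faceChain_ne_zero.mp h
    simpa using T.mem_of_mem_convexHull (v := v) hf
      (by rw [coe_image_insert_pair, mem_convexHull_triple_iff hpos]; exact ⟨hab, hbc, hca⟩)

theorem eq_of_faceChain_ne_zero (T : PointTriangulation z) (hc : T.faceChain a b c ≠ 0)
    (hd : T.faceChain a b d ≠ 0) : c = d := by
  obtain ⟨hfc, hc⟩ := faceChain_ne_zero.mp hc
  obtain ⟨hfd, hd⟩ := faceChain_ne_zero.mp hd
  by_contra hcd
  obtain ⟨t, ⟨htc, htd⟩, ht⟩ := ((eventually_lineMap_midpoint_mem_convexHull hc hc).and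
    (eventually_lineMap_midpoint_mem_convexHull hd hc)).and self_mem_nhdsWithin |>.exists
  have hmem := Set.mem_inter htc htd
  rw [← coe_image_insert_pair, ← coe_image_insert_pair, T.inter_face _ hfc _ hfd] at hmem
  have hzero := orient_eq_zero_of_mem_convexHull (a := z a) (b := z b) ?_ hmem
  · simp only [orient_lineMap, orient_midpoint, orient_self_outer, orient_self_right, add_zero,
      zero_div, mul_zero, zero_add] at hzero
    exact (mul_pos ht hc).ne' hzero
  · rintro - ⟨v, hv, rfl⟩
    have hvab : v = a ∨ v = b := by simpa using (by grind : v ∈ ({a, b} : Finset ι))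
    rcases hvab with rfl | rfl <;> simp

theorem exists_faceChain_swap_ne_zero (T : PointTriangulation z) (hc : T.faceChain a b c ≠ 0)
    (hw : orient (z a) (z b) (z w) < 0) : ∃ d, T.faceChain b a d ≠ 0 := by
  have hempty := T.isEmptyTriangle_of_faceChain_ne_zero hc
  obtain ⟨hfc, hpos⟩ := faceChain_ne_zero.mp hc
  have hrange (v : ι) : z v ∈ convexHull ℝ (Set.range z) :=
    subset_convexHull ℝ _ (Set.mem_range_self v)
  have hmid {S : Set ℂ} (ha : z a ∈ convexHull ℝ S) (hb : z b ∈ convexHull ℝ S) :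
      midpoint ℝ (z a) (z b) ∈ convexHull ℝ S :=
    (convex_convexHull ℝ S).midpoint_mem ha hb
  obtain ⟨g, hg, hmidg, t, ht, htg⟩ :=
    T.exists_mem_convexHull_and_lineMap_mem (hmid (hrange a) (hrange b)) (hrange w)
  have hinter : midpoint ℝ (z a) (z b) ∈
      convexHull ℝ (z '' ((({a, b, c} : Finset ι) : Set ι) ∩ (g : Set ι))) := by
    rw [← T.inter_face _ hfc _ hg]
    exact ⟨hmid (subset_convexHull ℝ _ ⟨a, by simp⟩) (subset_convexHull ℝ _ ⟨b, by simp⟩), hmidg⟩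
  obtain ⟨ha, hb⟩ := T.mem_and_mem_of_midpoint_mem hempty hg Set.inter_subset_right
    (fun v hv => by
      have hvabc : v = a ∨ v = b ∨ v = c := by simpa using hv.1
      rcases hvabc with rfl | rfl | rfl <;> simp [hpos.le]) hinter
  obtain ⟨d, rfl, -⟩ := T.exists_eq_insert_pair hg hempty.ne.1 ha hb
  refine ⟨d, faceChain_ne_zero.mpr ⟨by rwa [Finset.insert_comm], ?_⟩⟩
  rw [orient_swap_left, neg_pos]
  by_contra! hcon
  have hnonneg := orient_nonneg_of_mem_convexHull (a := z a) (b := z b)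
    (by rw [coe_image_insert_pair]; simp [hcon]) htg
  simp only [orient_lineMap, orient_midpoint, orient_self_outer, orient_self_right, add_zero,
    zero_div, mul_zero, zero_add] at hnonneg
  exact (mul_neg_of_pos_of_neg ht hw).not_ge hnonneg

theorem exists_faceChain_ne_zero_of_forall_orient_nonneg (T T' : PointTriangulation z)
    (hc : T.faceChain a b c ≠ 0) (h : ∀ v, 0 ≤ orient (z a) (z b) (z v)) :
    ∃ d, T'.faceChain a b d ≠ 0 := by
  have hempty := T.isEmptyTriangle_of_faceChain_ne_zero hc
  have hmid : midpoint ℝ (z a) (z b) ∈ convexHull ℝ (Set.range z) :=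
    (convex_convexHull ℝ _).midpoint_mem (subset_convexHull ℝ _ (Set.mem_range_self a))
      (subset_convexHull ℝ _ (Set.mem_range_self b))
  simp only [← T'.iUnion_face, Set.mem_iUnion, exists_prop] at hmid
  obtain ⟨g, hg, hmidg⟩ := hmid
  obtain ⟨ha, hb⟩ := T'.mem_and_mem_of_midpoint_mem hempty hg subset_rfl (fun v _ => h v) hmidg
  obtain ⟨d, rfl, hd⟩ := T'.exists_eq_insert_pair hg hempty.ne.1 ha hb
  exact ⟨d, faceChain_ne_zero.mpr ⟨hg, (h d).lt_of_ne' hd⟩⟩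

theorem faceChain_swap_eq_zero (T : PointTriangulation z)
    (h : ∀ v, 0 ≤ orient (z a) (z b) (z v)) (c : ι) : T.faceChain b a c = 0 := by
  by_contra hne
  have hpos := (faceChain_ne_zero.mp hne).2
  rw [orient_swap_left, neg_pos] at hpos
  exact hpos.not_ge (h c)

theorem IsDelaunay.circumpower_nonneg {T : PointTriangulation z} (hT : T.IsDelaunay)
    (h : T.faceChain a b c ≠ 0) (w : ι) : 0 ≤ circumpower (z a) (z b) (z c) (z w) := by
  obtain ⟨hf, hpos⟩ := faceChain_ne_zero.mp h
  refine circlePower_nonneg_iff.mpr (hT _ hf _ _ ?_ w)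
  simp [circlePower_eq_zero_iff.mp (circumpower_snd hpos.ne'),
    circlePower_eq_zero_iff.mp (circumpower_thd hpos.ne')]

theorem indicator_insert_pair_eq_triangleChain {p q r : ι} (h : 0 < orient (z p) (z q) (z r))
    (a b c : ι) :
    (if ({p, q, r} : Finset ι) = {a, b, c} ∧ 0 < orient (z a) (z b) (z c) then 1 else 0) =
      triangleChain p q r a b c := by
  have hne {x y w : ι} (hxyw : 0 < orient (z x) (z y) (z w)) : x ≠ y ∧ y ≠ w ∧ w ≠ x := by
    have hz := ne_of_orient_ne_zero hxyw.ne'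
    exact ⟨ne_of_apply_ne z hz.1, ne_of_apply_ne z hz.2.1, ne_of_apply_ne z hz.2.2⟩
  have hqrp : 0 < orient (z q) (z r) (z p) := by rwa [orient_rotate]
  have hrpq : 0 < orient (z r) (z p) (z q) := by rwa [orient_rotate]
  have hodd {x y w : ι} (hxyw : 0 < orient (z x) (z y) (z w)) :
      ¬0 < orient (z y) (z x) (z w) := by
    rw [orient_swap_left]
    linarith
  have hiff : ({p, q, r} : Finset ι) = {a, b, c} ∧ 0 < orient (z a) (z b) (z c) ↔
      (a = p ∧ b = q ∧ c = r) ∨ (a = q ∧ b = r ∧ c = p) ∨ (a = r ∧ b = p ∧ c = q) := by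
    refine ⟨fun ⟨heq, habc⟩ => ?_, ?_⟩
    · have hmem (x : ι) (hx : x ∈ ({a, b, c} : Finset ι)) : x = p ∨ x = q ∨ x = r := by
        simpa [← heq] using hx
      obtain ⟨hab, hbc, hca⟩ := hne habc
      have hqpr := hodd h
      have hrqp := hodd hqrp
      have hprq := hodd hrpq
      rcases hmem a (by simp) with rfl | rfl | rfl <;>
        rcases hmem b (by simp) with rfl | rfl | rfl <;>
        rcases hmem c (by simp) with rfl | rfl | rfl <;> tauto
    · rintro (⟨rfl, rfl, rfl⟩ | ⟨rfl, rfl, rfl⟩ | ⟨rfl, rfl, rfl⟩)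
      · exact ⟨rfl, h⟩
      · exact ⟨by grind, hqrp⟩
      · exact ⟨by grind, hrpq⟩
  have := hne h
  simp only [hiff, triangleChain]
  grind

variable [Fintype ι]

theorem sum_faceChain_eq_one (T : PointTriangulation z) (hc : T.faceChain a b c ≠ 0) :
    ∑ d, T.faceChain a b d = 1 := by
  rw [Finset.sum_eq_single c]
  · exact if_pos (faceChain_ne_zero.mp hc)
  · intro d _ hdc
    by_contra hd
    exact hdc (T.eq_of_faceChain_ne_zero hd hc)
  · simp

theorem sum_faceChain_congr (T T' : PointTriangulation z) {a' b' : ι}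
    (h : (∃ c, T.faceChain a b c ≠ 0) ↔ ∃ c, T'.faceChain a' b' c ≠ 0) :
    ∑ c, T.faceChain a b c = ∑ c, T'.faceChain a' b' c := by
  by_cases hT : ∃ c, T.faceChain a b c ≠ 0
  · obtain ⟨d, hd⟩ := h.mp hT
    rw [T.sum_faceChain_eq_one hT.choose_spec, T'.sum_faceChain_eq_one hd]
  · have hT' := mt h.mpr hT
    push Not at hT hT'
    simp [hT, hT']

theorem sum_faceChain_eq_sum_swap (T : PointTriangulation z) (hv : orient (z a) (z b) (z v) < 0)
    (hw : orient (z b) (z a) (z w) < 0) : ∑ c, T.faceChain a b c = ∑ c, T.faceChain b a c :=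
  T.sum_faceChain_congr T ⟨fun ⟨_, hc⟩ => T.exists_faceChain_swap_ne_zero hc hv,
    fun ⟨_, hc⟩ => T.exists_faceChain_swap_ne_zero hc hw⟩

theorem sum_faceChain_eq_of_forall_orient_nonneg (T T' : PointTriangulation z)
    (h : ∀ v, 0 ≤ orient (z a) (z b) (z v)) :
    ∑ c, T.faceChain a b c = ∑ c, T'.faceChain a b c ∧
      ∑ c, T.faceChain b a c = ∑ c, T'.faceChain b a c := by
  refine ⟨T.sum_faceChain_congr T'
    ⟨fun ⟨_, hc⟩ => T.exists_faceChain_ne_zero_of_forall_orient_nonneg T' hc h,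
      fun ⟨_, hc⟩ => T'.exists_faceChain_ne_zero_of_forall_orient_nonneg T hc h⟩, ?_⟩
  simp only [T.faceChain_swap_eq_zero h, T'.faceChain_swap_eq_zero h]

theorem boundary_faceChain_eq (T T' : PointTriangulation z) (a b : ι) :
    ∑ c, T.faceChain a b c - ∑ c, T.faceChain b a c =
      ∑ c, T'.faceChain a b c - ∑ c, T'.faceChain b a c := by
  by_cases hab : ∀ v, 0 ≤ orient (z a) (z b) (z v)
  · obtain ⟨h, h'⟩ := T.sum_faceChain_eq_of_forall_orient_nonneg T' hab
    rw [h, h']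
  by_cases hba : ∀ v, 0 ≤ orient (z b) (z a) (z v)
  · obtain ⟨h, h'⟩ := T.sum_faceChain_eq_of_forall_orient_nonneg T' hba
    rw [h, h']
  push Not at hab hba
  obtain ⟨v, hv⟩ := hab
  obtain ⟨w, hw⟩ := hba
  rw [T.sum_faceChain_eq_sum_swap hv hw, T'.sum_faceChain_eq_sum_swap hv hw, sub_self, sub_self]

theorem orient_nonneg_of_boundary_pos (T : PointTriangulation z)
    (h : 0 < ∑ c, T.faceChain a b c - ∑ c, T.faceChain b a c) (v : ι) :
    0 ≤ orient (z a) (z b) (z v) := by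
  by_contra! hv
  rw [sub_pos] at h
  have hnonneg : 0 ≤ ∑ c, T.faceChain b a c := Finset.sum_nonneg fun c _ => by
    unfold faceChain
    positivity
  obtain ⟨c, -, hc⟩ := Finset.exists_ne_zero_of_sum_ne_zero (hnonneg.trans_lt h).ne'
  obtain ⟨d, hd⟩ := T.exists_faceChain_swap_ne_zero hc hv
  rw [T.sum_faceChain_eq_one hc, T.sum_faceChain_eq_one hd] at h
  exact h.false

theorem isFilling_faceChain (T T' : PointTriangulation z) :
    IsFilling z (fun a b => ∑ c, T'.faceChain a b c - ∑ c, T'.faceChain b a c) T.faceChain where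
  nonneg a b c := by unfold faceChain; positivity
  rotate := T.faceChain_rotate
  isEmptyTriangle := T.isEmptyTriangle_of_faceChain_ne_zero
  boundary := T.boundary_faceChain_eq T'

theorem sum_faceChain_mul (T : PointTriangulation z) (F : Finset ι → ℝ) :
    ∑ a, ∑ b, ∑ c, (T.faceChain a b c : ℝ) * F {a, b, c} = 3 * ∑ f ∈ T.faces, F f := by
  have hrotate (a b c : ι) : F {b, c, a} = F {a, b, c} := by
    rw [Finset.pair_comm, Finset.insert_comm]
  have hchain (a b c : ι) : (T.faceChain a b c : ℝ) * F {a, b, c} = ∑ f ∈ T.faces,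
      ((if f = {a, b, c} ∧ 0 < orient (z a) (z b) (z c) then 1 else 0 : ℤ) : ℝ) *
        F {a, b, c} := by
    rw [← Finset.sum_mul, ← Int.cast_sum]
    simp [faceChain, ite_and]
  simp only [hchain, Finset.sum_comm (t := T.faces), Finset.mul_sum]
  refine Finset.sum_congr rfl fun f hf => ?_
  obtain ⟨p, q, r, rfl, hpos⟩ := T.exists_orient_pos hf
  simp only [indicator_insert_pair_eq_triangleChain hpos,
    sum_triangleChain_mul p q r (fun a b c => F {a, b, c}) hrotate]

end PointTriangulation

end Triangulations

section IdealVolume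

open Real (sin cos)
open scoped ENNReal

/-- The hyperbolic volume, per unit of Euclidean area of the base, of a thin vertical column over a
point of power `p` with respect to the circle bounding a hemisphere, above that hemisphere. -/
noncomputable def fibreVolume (p : ℝ) : ℝ≥0∞ :=
  ∫⁻ h in {h : ℝ | 0 < h ∧ 0 ≤ p + h ^ 2}, ENNReal.ofReal (1 / h ^ 3)

theorem measurable_fibreVolume : Measurable fibreVolume :=
  Monotone.measurable fun _ _ hpq =>
    lintegral_mono_set fun _ hh => ⟨hh.1, hh.2.trans (add_le_add_left hpq _)⟩

theorem lintegral_Ici_one_div_pow_three {s : ℝ} (hs : 0 < s) :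
    ∫⁻ h in Set.Ici s, ENNReal.ofReal (1 / h ^ 3) = ENNReal.ofReal (1 / (2 * s ^ 2)) := by
  have hpow : ∀ h ∈ Set.Ioi s, h ^ (-3 : ℝ) = 1 / h ^ 3 := fun h hh => by
    rw [Real.rpow_neg (hs.trans hh).le, one_div]
    norm_cast
  have hint : IntegrableOn (fun h : ℝ => 1 / h ^ 3) (Set.Ioi s) :=
    (integrableOn_Ioi_rpow_of_lt (by norm_num) hs).congr_fun hpow measurableSet_Ioi
  have hnonneg : 0 ≤ᵐ[volume.restrict (Set.Ioi s)] fun h : ℝ => 1 / h ^ 3 := by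
    filter_upwards [ae_restrict_mem measurableSet_Ioi] with h hh
    have : 0 < h := hs.trans hh
    positivity
  rw [← restrict_Ioi_eq_restrict_Ici, ← ofReal_integral_eq_lintegral_ofReal hint hnonneg,
    ← setIntegral_congr_fun measurableSet_Ioi hpow, integral_Ioi_rpow_of_lt (by norm_num) hs,
    show (-3 + 1 : ℝ) = -(2 : ℕ) by norm_num, Real.rpow_neg hs.le, Real.rpow_natCast]
  congr 1
  push_cast
  field_simp

theorem fibreVolume_of_neg {p : ℝ} (hp : p < 0) :
    fibreVolume p = ENNReal.ofReal (1 / (2 * -p)) := by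
  have hs : 0 < √(-p) := Real.sqrt_pos.mpr (neg_pos.mpr hp)
  have hset : {h : ℝ | 0 < h ∧ 0 ≤ p + h ^ 2} = Set.Ici √(-p) := by
    ext h
    refine ⟨fun ⟨h0, hh⟩ => Real.sqrt_le_iff.mpr ⟨h0.le, by linarith⟩, fun hh => ?_⟩
    have h0 : 0 < h := hs.trans_le hh
    exact ⟨h0, by linarith [(Real.sqrt_le_left h0.le).mp hh]⟩
  rw [fibreVolume, hset, lintegral_Ici_one_div_pow_three hs, Real.sq_sqrt (neg_pos.mpr hp).le]

theorem measurable_circumpower (a b c : ℂ) : Measurable (circumpower a b c) := by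
  unfold circumpower circlePower
  fun_prop

theorem measurableSet_convexHull_triple (a b c : ℂ) : MeasurableSet (convexHull ℝ {a, b, c}) :=
  ((Set.toFinite _).isCompact_convexHull ℝ).isClosed.measurableSet

theorem mem_idealTetrahedron_iff {a b c : ℂ} (h : 0 < orient a b c) (p : ℂ × ℝ) :
    p ∈ idealTetrahedron {a, b, c} ↔
      p.1 ∈ convexHull ℝ {a, b, c} ∧ 0 < p.2 ∧ 0 ≤ circumpower a b c p.1 + p.2 ^ 2 := by
  have hb := circlePower_eq_zero_iff.mp (circumpower_snd h.ne')
  have hc := circlePower_eq_zero_iff.mp (circumpower_thd h.ne')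
  rw [circumpower, circlePower_eq_dist]
  refine and_congr_right fun _ => and_congr_right fun _ => ⟨fun H => ?_, fun H o R hR => ?_⟩
  · linarith [H (circumcenter a b c) (dist a (circumcenter a b c)) (by simp [hb, hc])]
  · have ha : dist a o = R := hR a (by simp)
    have ho : o = circumcenter a b c := eq_circumcenter_of_circlePower_eq_zero h.ne'
      (circlePower_eq_zero_iff.mpr (by rw [hR b (by simp), ha]))
      (circlePower_eq_zero_iff.mpr (by rw [hR c (by simp), ha]))
    rw [← ho, ha] at H
    linarith

theorem measurableSet_idealTetrahedron {a b c : ℂ} (h : 0 < orient a b c) :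
    MeasurableSet (idealTetrahedron {a, b, c}) := by
  have heq : idealTetrahedron {a, b, c} = Prod.fst ⁻¹' convexHull ℝ {a, b, c} ∩
      ({p : ℂ × ℝ | 0 < p.2} ∩ {p : ℂ × ℝ | 0 ≤ circumpower a b c p.1 + p.2 ^ 2}) :=
    Set.ext (mem_idealTetrahedron_iff h)
  rw [heq]
  exact (measurable_fst (measurableSet_convexHull_triple a b c)).inter
    ((measurableSet_lt measurable_const measurable_snd).inter (measurableSet_le measurable_const
      (((measurable_circumpower a b c).comp measurable_fst).add (measurable_snd.pow_const 2))))

theorem idealVolume_eq_toReal_lintegral {a b c : ℂ} (h : 0 < orient a b c) :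
    idealVolume {a, b, c} =
      (∫⁻ w in convexHull ℝ {a, b, c}, fibreVolume (circumpower a b c w)).toReal := by
  have hset := measurableSet_idealTetrahedron h
  have hdens : Measurable fun p : ℂ × ℝ => ENNReal.ofReal (1 / p.2 ^ 3) := by fun_prop
  have hinter : idealTetrahedron {a, b, c} ∩ {p : ℂ × ℝ | 0 < p.2} = idealTetrahedron {a, b, c} :=
    Set.inter_eq_left.mpr fun p hp => hp.2.1
  rw [idealVolume, Measure.real, hyperbolicVolume, withDensity_apply _ hset,
    Measure.restrict_restrict hset, hinter, ← lintegral_indicator hset, Measure.volume_eq_prod,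
    lintegral_prod _ (hdens.indicator hset).aemeasurable,
    ← lintegral_indicator (measurableSet_convexHull_triple a b c)]
  congr 1
  refine lintegral_congr fun w => ?_
  have hfibre : MeasurableSet {x : ℝ | 0 < x ∧ 0 ≤ circumpower a b c w + x ^ 2} :=
    (measurableSet_lt measurable_const measurable_id).inter
      (measurableSet_le measurable_const (measurable_const.add (measurable_id.pow_const 2)))
  by_cases hw : w ∈ convexHull ℝ {a, b, c}
  · rw [Set.indicator_of_mem hw, fibreVolume, ← lintegral_indicator hfibre]
    simp only [Set.indicator, mem_idealTetrahedron_iff h, hw, true_and, Set.mem_ofPred_eq]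
  · simp [Set.indicator, mem_idealTetrahedron_iff h, hw]

theorem lintegral_Ioc_inv_sub {ρ q : ℝ} (hρ : 0 < ρ) (hq : ρ < q) :
    ∫⁻ r in Set.Ioc 0 ρ, ENNReal.ofReal (1 / 2 * (q - r)⁻¹) =
      ENNReal.ofReal (1 / 2 * Real.log (q / (q - ρ))) := by
  have hpos : ∀ r ∈ Set.Icc 0 ρ, 0 < q - r := fun r hr => sub_pos.mpr (hr.2.trans_lt hq)
  have hint : IntegrableOn (fun r => 1 / 2 * (q - r)⁻¹) (Set.Icc 0 ρ) :=
    (continuousOn_const.mul (ContinuousOn.inv₀ (by fun_prop) fun r hr =>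
      (hpos r hr).ne')).integrableOn_Icc
  rw [← ofReal_integral_eq_lintegral_ofReal (hint.mono_set Set.Ioc_subset_Icc_self),
    ← intervalIntegral.integral_of_le hρ.le, intervalIntegral.integral_const_mul,
    intervalIntegral.integral_comp_sub_left (fun x => x⁻¹), sub_zero,
    integral_inv_of_pos (by linarith) (by linarith)]
  filter_upwards [ae_restrict_mem measurableSet_Ioc] with r hr
  have := hpos r (Set.Ioc_subset_Icc_self hr)
  positivity

/-- The point whose polar coordinates around `a` are `(r, θ)`, angles being measured from the
direction of the unit vector `u`. -/
noncomputable def polarPoint (a u : ℂ) (r θ : ℝ) : ℂ := a + u * Complex.polarCoord.symm (r, θ)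

section Polar

variable {a u : ℂ}

theorem measurable_polarPoint (a u : ℂ) :
    Measurable fun p : ℝ × ℝ => polarPoint a u p.1 p.2 := by
  simp only [polarPoint, Complex.polarCoord_symm_apply]
  fun_prop

theorem normSq_polarPoint_sub (hu : ‖u‖ = 1) (r θ : ℝ) :
    Complex.normSq (polarPoint a u r θ - a) = r ^ 2 := by
  rw [polarPoint, add_sub_cancel_left, Complex.normSq_eq_norm_sq, norm_mul, hu, one_mul,
    Complex.norm_polarCoord_symm, sq_abs]

theorem orient_polarPoint (hu : ‖u‖ = 1) (r θ s φ : ℝ) :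
    orient a (polarPoint a u r θ) (polarPoint a u s φ) = r * s * sin (φ - θ) := by
  have hu' : u.re * u.re + u.im * u.im = 1 := by
    rw [← Complex.normSq_apply, Complex.normSq_eq_norm_sq, hu, one_pow]
  simp only [orient, polarPoint, Complex.polarCoord_symm_apply, Complex.add_re, Complex.add_im,
    Complex.mul_re, Complex.mul_im, Complex.ofReal_re, Complex.ofReal_im, Complex.I_re,
    Complex.I_im, Real.sin_sub]
  linear_combination r * s * (sin φ * cos θ - cos φ * sin θ) * hu'

theorem lintegral_add_mul (a : ℂ) (hu : ‖u‖ = 1) (F : ℂ → ℝ≥0∞) :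
    ∫⁻ w, F (a + u * w) = ∫⁻ w, F w := by
  rw [← lintegral_add_left_eq_self F a]
  exact (rotation ⟨u, mem_sphere_zero_iff_norm.mpr hu⟩).measurePreserving.lintegral_comp_emb
    (rotation _).toHomeomorph.measurableEmbedding fun w => F (a + w)

theorem lintegral_eq_lintegral_polarPoint (a : ℂ) (hu : ‖u‖ = 1) {F : ℂ → ℝ≥0∞}
    (hF : Measurable F) :
    ∫⁻ w, F w = ∫⁻ θ in Set.Ioo (-Real.pi) Real.pi, ∫⁻ r in Set.Ioi 0,
      ENNReal.ofReal r * F (polarPoint a u r θ) := by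
  have := measurable_polarPoint a u
  rw [← lintegral_add_mul a hu, ← Complex.lintegral_comp_polarCoord_symm, polarCoord_target,
    Measure.volume_eq_prod, setLIntegral_prod_symm]
  · rfl
  · exact Measurable.aemeasurable (by unfold polarPoint at this; fun_prop)

end Polar

/-- The angles `α`, `β`, `γ` are those of a nondegenerate Euclidean triangle. -/
structure IsAngleTriple (α β γ : ℝ) : Prop where
  fst_pos : 0 < α
  snd_pos : 0 < β
  thd_pos : 0 < γ
  add_add_eq_pi : α + β + γ = Real.pi

namespace IsAngleTriple

variable {α β γ θ : ℝ}

theorem swap (h : IsAngleTriple α β γ) : IsAngleTriple α γ β :=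
  ⟨h.fst_pos, h.thd_pos, h.snd_pos, by linarith [h.add_add_eq_pi]⟩

theorem sin_fst_pos (h : IsAngleTriple α β γ) : 0 < sin α :=
  Real.sin_pos_of_pos_of_lt_pi h.fst_pos
    (by linarith [h.snd_pos, h.thd_pos, h.add_add_eq_pi])

theorem sin_snd_pos (h : IsAngleTriple α β γ) : 0 < sin β :=
  Real.sin_pos_of_pos_of_lt_pi h.snd_pos
    (by linarith [h.fst_pos, h.thd_pos, h.add_add_eq_pi])

theorem sin_snd_add_pos (h : IsAngleTriple α β γ) (hθ : θ ∈ Set.Ioo 0 α) : 0 < sin (β + θ) :=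
  Real.sin_pos_of_pos_of_lt_pi (add_pos h.snd_pos hθ.1)
    (by linarith [hθ.2, h.thd_pos, h.add_add_eq_pi])

theorem sin_ray_pos (h : IsAngleTriple α β γ) (hθ : θ ∈ Set.Ioo 0 α) : 0 < sin θ :=
  Real.sin_pos_of_pos_of_lt_pi hθ.1
    (by linarith [hθ.2, h.snd_pos, h.thd_pos, h.add_add_eq_pi])

theorem sin_fst_sub_pos (h : IsAngleTriple α β γ) (hθ : θ ∈ Set.Ioo 0 α) : 0 < sin (α - θ) :=
  h.sin_ray_pos ⟨by linarith [hθ.2], by linarith [hθ.1]⟩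

theorem sin_mul_sin_sub_add (h : IsAngleTriple α β γ) (θ : ℝ) :
    sin γ * sin (α - θ) + sin β * sin θ = sin α * sin (γ + θ) := by
  rw [show β = Real.pi - (α + γ) by linarith [h.add_add_eq_pi], Real.sin_pi_sub, Real.sin_sub,
    Real.sin_add, Real.sin_add]
  ring

theorem sin_add_mul_sin_add (h : IsAngleTriple α β γ) (θ : ℝ) :
    sin (γ + θ) * sin (β + θ) = sin β * sin γ + sin θ * sin (α - θ) := by
  rw [show α - θ = Real.pi - (β + γ + θ) by linarith [h.add_add_eq_pi], Real.sin_pi_sub]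
  simp only [Real.sin_add, Real.cos_add]
  linear_combination sin β * sin γ * Real.sin_sq_add_cos_sq θ

end IsAngleTriple

section Ray

variable {a u : ℂ} {D α β γ θ r : ℝ}

theorem orient_polarPoint_pos (hu : ‖u‖ = 1) (hD : 0 < D) (h : IsAngleTriple α β γ) :
    0 < orient a (polarPoint a u (D * sin γ) 0) (polarPoint a u (D * sin β) α) := by
  have := h.sin_fst_pos
  have := h.sin_snd_pos
  have := h.swap.sin_snd_pos
  rw [orient_polarPoint hu, sub_zero]
  positivity

theorem circumpower_polarPoint (hu : ‖u‖ = 1) (hD : 0 < D) (h : IsAngleTriple α β γ) (r θ : ℝ) :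
    circumpower a (polarPoint a u (D * sin γ) 0) (polarPoint a u (D * sin β) α)
      (polarPoint a u r θ) = -(r * (D * sin (γ + θ) - r)) := by
  have hpos := orient_polarPoint_pos (a := a) hu hD h
  have horient := orient_polarPoint (a := a) hu (D * sin γ) 0 (D * sin β) α
  have habw := orient_polarPoint (a := a) hu (D * sin γ) 0 r θ
  have hawc := orient_polarPoint (a := a) hu r θ (D * sin β) α
  have hbb := normSq_polarPoint_sub (a := a) hu (D * sin γ) 0
  have hcc := normSq_polarPoint_sub (a := a) hu (D * sin β) α
  have hww := normSq_polarPoint_sub (a := a) hu r θ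
  set b := polarPoint a u (D * sin γ) 0
  set c := polarPoint a u (D * sin β) α
  set w := polarPoint a u r θ
  rw [← orient_rotate, ← orient_rotate] at hpos
  rw [circumpower_rotate hpos.ne']
  refine mul_left_cancel₀ hpos.ne' ?_
  rw [orient_mul_circumpower hpos.ne', hww, hbb, habw, ← Complex.normSq_neg (a - c), neg_sub, hcc,
    ← orient_rotate c a w, hawc, ← orient_rotate c a b, horient, sub_zero, sub_zero]
  linear_combination -r * D ^ 3 * sin β * sin γ * h.sin_mul_sin_sub_add θ

theorem polarPoint_mem_convexHull_iff (hu : ‖u‖ = 1) (hD : 0 < D) (h : IsAngleTriple α β γ)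
    (r θ : ℝ) :
    polarPoint a u r θ ∈ convexHull ℝ {a, polarPoint a u (D * sin γ) 0,
        polarPoint a u (D * sin β) α} ↔
      0 ≤ r * sin θ ∧ r * sin (β + θ) ≤ D * (sin β * sin γ) ∧ 0 ≤ r * sin (α - θ) := by
  have hα := h.sin_fst_pos
  have hβ := h.sin_snd_pos
  have hγ := h.swap.sin_snd_pos
  have hpos := orient_polarPoint_pos (a := a) hu hD h
  have horient := orient_polarPoint (a := a) hu (D * sin γ) 0 (D * sin β) α
  have habw := orient_polarPoint (a := a) hu (D * sin γ) 0 r θ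
  have hawc := orient_polarPoint (a := a) hu r θ (D * sin β) α
  set b := polarPoint a u (D * sin γ) 0
  set c := polarPoint a u (D * sin β) α
  set w := polarPoint a u r θ
  rw [sub_zero] at horient habw
  have hab : orient a b w = D * sin γ * (r * sin θ) := by rw [habw]; ring
  have hca : orient c a w = D * sin β * (r * sin (α - θ)) := by
    rw [← orient_rotate, hawc]; ring
  have hbc : orient b c w = D * sin α * (D * (sin β * sin γ) - r * sin (β + θ)) := by
    have hsum := orient_add_orient_add_orient a b c w
    rw [hab, hca, horient] at hsum
    linear_combination hsum - D * r * h.swap.sin_mul_sin_sub_add θ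
  rw [mem_convexHull_triple_iff hpos, hab, hbc, hca, mul_nonneg_iff_of_pos_left (mul_pos hD hγ),
    mul_nonneg_iff_of_pos_left (mul_pos hD hα), mul_nonneg_iff_of_pos_left (mul_pos hD hβ),
    sub_nonneg]

end Ray

/-- The volume, per unit angle, of a thin wedge of the ideal tetrahedron over a Euclidean triangle
with angles `α`, `β`, `γ`, bounded by vertical planes through the vertex of angle `α`; here `θ` is
the angle to the side with end angles `α` and `β`. -/
noncomputable def rayVolume (α β γ θ : ℝ) : ℝ :=
  1 / 2 * Real.log (sin (γ + θ) * sin (β + θ) / (sin θ * sin (α - θ)))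

section Ray

variable {a u : ℂ} {D α β γ θ r : ℝ}

theorem polarPoint_mem_convexHull_iff_le (hu : ‖u‖ = 1) (hD : 0 < D) (h : IsAngleTriple α β γ)
    (hθ : θ ∈ Set.Ioo 0 α) (hr : 0 < r) :
    polarPoint a u r θ ∈ convexHull ℝ {a, polarPoint a u (D * sin γ) 0,
        polarPoint a u (D * sin β) α} ↔ r ≤ D * (sin β * sin γ) / sin (β + θ) := by
  rw [polarPoint_mem_convexHull_iff hu hD h, le_div_iff₀ (h.sin_snd_add_pos hθ),
    and_iff_right (mul_pos hr (h.sin_ray_pos hθ)).le,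
    and_iff_left (mul_pos hr (h.sin_fst_sub_pos hθ)).le]

theorem polarPoint_notMem_convexHull (hu : ‖u‖ = 1) (hD : 0 < D) (h : IsAngleTriple α β γ)
    (hθ : θ ∈ Set.Ioo (-Real.pi) Real.pi) (hθα : θ ∉ Set.Icc 0 α) (hr : 0 < r) :
    polarPoint a u r θ ∉ convexHull ℝ {a, polarPoint a u (D * sin γ) 0,
        polarPoint a u (D * sin β) α} := by
  rw [polarPoint_mem_convexHull_iff hu hD h, mul_nonneg_iff_of_pos_left hr,
    mul_nonneg_iff_of_pos_left hr]
  rintro ⟨hsin, -, hsin'⟩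
  refine hθα ⟨?_, ?_⟩
  · by_contra! hneg
    exact hsin.not_gt (Real.sin_neg_of_neg_of_neg_pi_lt hneg hθ.1)
  · by_contra! hlt
    exact hsin'.not_gt (Real.sin_neg_of_neg_of_neg_pi_lt (by linarith)
      (by linarith [hθ.2, h.fst_pos]))

theorem lintegral_ray_fibreVolume (hu : ‖u‖ = 1) (hD : 0 < D) (h : IsAngleTriple α β γ)
    (hθ : θ ∈ Set.Ioo 0 α) :
    ∫⁻ r in Set.Ioi 0, ENNReal.ofReal r * (convexHull ℝ {a, polarPoint a u (D * sin γ) 0,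
      polarPoint a u (D * sin β) α}).indicator (fun w => fibreVolume (circumpower a
        (polarPoint a u (D * sin γ) 0) (polarPoint a u (D * sin β) α) w)) (polarPoint a u r θ) =
      ENNReal.ofReal (rayVolume α β γ θ) := by
  have hβ := h.sin_snd_pos
  have hγ := h.swap.sin_snd_pos
  have hβθ := h.sin_snd_add_pos hθ
  have hθ0 := h.sin_ray_pos hθ
  have hαθ := h.sin_fst_sub_pos hθ
  set ρ := D * (sin β * sin γ) / sin (β + θ) with hρ
  set q := D * sin (γ + θ) with hq
  have hsub : q - ρ = D * (sin θ * sin (α - θ)) / sin (β + θ) := by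
    rw [hρ, hq, eq_div_iff hβθ.ne', sub_mul, div_mul_cancel₀ _ hβθ.ne']
    linear_combination D * h.sin_add_mul_sin_add θ
  have hρ0 : 0 < ρ := by positivity
  have hρq : ρ < q := sub_pos.mp (hsub ▸ by positivity)
  have hratio : q / (q - ρ) = sin (γ + θ) * sin (β + θ) / (sin θ * sin (α - θ)) := by
    rw [hsub, hq]
    field_simp
  rw [rayVolume, ← hratio, ← lintegral_Ioc_inv_sub hρ0 hρq,
    ← lintegral_indicator measurableSet_Ioi, ← lintegral_indicator measurableSet_Ioc]
  refine lintegral_congr fun r => ?_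
  by_cases hr : r ∈ Set.Ioc 0 ρ
  · have hqr : 0 < q - r := sub_pos.mpr (hr.2.trans_lt hρq)
    rw [Set.indicator_of_mem hr, Set.indicator_of_mem (Set.mem_Ioi.mpr hr.1), Set.indicator_of_mem
      ((polarPoint_mem_convexHull_iff_le hu hD h hθ hr.1).mpr hr.2), circumpower_polarPoint hu hD h,
      fibreVolume_of_neg (neg_neg_of_pos (mul_pos hr.1 hqr)), ← ENNReal.ofReal_mul hr.1.le]
    congr 1
    have := hr.1
    field_simp
  · rw [Set.indicator_of_notMem hr]
    refine Set.indicator_apply_eq_zero.mpr fun hr0 => ?_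
    rw [Set.indicator_of_notMem (fun hmem => hr ⟨hr0,
      (polarPoint_mem_convexHull_iff_le hu hD h hθ hr0).mp hmem⟩), mul_zero]

theorem lintegral_fibreVolume (hu : ‖u‖ = 1) (hD : 0 < D) (h : IsAngleTriple α β γ) :
    ∫⁻ w in convexHull ℝ {a, polarPoint a u (D * sin γ) 0, polarPoint a u (D * sin β) α},
      fibreVolume (circumpower a (polarPoint a u (D * sin γ) 0) (polarPoint a u (D * sin β) α) w) =
      ∫⁻ θ in Set.Ioo 0 α, ENNReal.ofReal (rayVolume α β γ θ) := by
  set b := polarPoint a u (D * sin γ) 0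
  set c := polarPoint a u (D * sin β) α
  have hhull := measurableSet_convexHull_triple a b c
  have hmeas : Measurable fun w => fibreVolume (circumpower a b c w) :=
    measurable_fibreVolume.comp (measurable_circumpower a b c)
  rw [← lintegral_indicator hhull,
    lintegral_eq_lintegral_polarPoint a hu (hmeas.indicator hhull),
    ← lintegral_indicator measurableSet_Ioo, ← lintegral_indicator measurableSet_Ioo]
  refine lintegral_congr_ae ?_
  filter_upwards [Measure.ae_ne volume 0, Measure.ae_ne volume α] with θ h0 hα
  by_cases hθ : θ ∈ Set.Ioo 0 α
  · have hθ' : θ ∈ Set.Ioo (-Real.pi) Real.pi :=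
      ⟨by linarith [hθ.1, Real.pi_pos], by linarith [hθ.2, h.snd_pos, h.thd_pos, h.add_add_eq_pi]⟩
    rw [Set.indicator_of_mem hθ, Set.indicator_of_mem hθ']
    exact lintegral_ray_fibreVolume hu hD h hθ
  · rw [Set.indicator_of_notMem hθ]
    refine Set.indicator_apply_eq_zero.mpr fun hθ' => ?_
    have hθα : θ ∉ Set.Icc 0 α := fun H => hθ ⟨H.1.lt_of_ne' h0, H.2.lt_of_ne hα⟩
    refine (setLIntegral_congr_fun measurableSet_Ioi fun r hr => ?_).trans lintegral_zero
    rw [Set.indicator_of_notMem (polarPoint_notMem_convexHull hu hD h hθ' hθα hr), mul_zero]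

end Ray

end IdealVolume

section AngleFormula

open Real (sin cos)

/-- The oriented angle at `a` from the ray through `b` to the ray through `c`; it lies in `(0, π)`
when `a b c` is positively oriented. -/
noncomputable def angleAt (a b c : ℂ) : ℝ := Complex.arg ((c - a) / (b - a))

/-- `∫₀ˣ log (sin t) dt`, which for `0 ≤ x ≤ π` is the Lobachevsky function up to sign and the
linear term `x log 2`. -/
noncomputable def logSinIntegral (x : ℝ) : ℝ := ∫ t in (0 : ℝ)..x, Real.log (sin t)

theorem intervalIntegrable_log_sin_real (x y : ℝ) :
    IntervalIntegrable (fun t => Real.log (sin t)) volume x y :=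
  intervalIntegrable_log_sin

theorem integral_log_sin_add (γ α : ℝ) :
    ∫ θ in (0 : ℝ)..α, Real.log (sin (γ + θ)) = logSinIntegral (γ + α) - logSinIntegral γ := by
  rw [intervalIntegral.integral_comp_add_left (fun x => Real.log (sin x)), add_zero,
    logSinIntegral, logSinIntegral, intervalIntegral.integral_interval_sub_left
      (intervalIntegrable_log_sin_real _ _) (intervalIntegrable_log_sin_real _ _)]

theorem integral_log_sin_sub (α : ℝ) :
    ∫ θ in (0 : ℝ)..α, Real.log (sin (α - θ)) = logSinIntegral α := by
  rw [intervalIntegral.integral_comp_sub_left (fun x => Real.log (sin x)), sub_self, sub_zero,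
    logSinIntegral]

theorem logSinIntegral_pi_sub (x : ℝ) :
    logSinIntegral (Real.pi - x) = logSinIntegral Real.pi - logSinIntegral x := by
  have hreflect := intervalIntegral.integral_comp_sub_left (a := 0) (b := x)
    (fun t => Real.log (sin t)) Real.pi
  simp only [Real.sin_pi_sub, sub_zero] at hreflect
  rw [logSinIntegral, logSinIntegral, logSinIntegral, hreflect, eq_sub_iff_add_eq,
    intervalIntegral.integral_add_adjacent_intervals (intervalIntegrable_log_sin_real _ _)
      (intervalIntegrable_log_sin_real _ _)]

namespace IsAngleTriple

variable {α β γ θ : ℝ}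

theorem rayVolume_nonneg (h : IsAngleTriple α β γ) (hθ : θ ∈ Set.Ioo 0 α) :
    0 ≤ rayVolume α β γ θ := by
  have hpos := mul_pos (h.sin_ray_pos hθ) (h.sin_fst_sub_pos hθ)
  refine mul_nonneg one_half_pos.le (Real.log_nonneg ((one_le_div hpos).mpr ?_))
  rw [h.sin_add_mul_sin_add]
  exact le_add_of_nonneg_left (mul_pos h.sin_snd_pos h.swap.sin_snd_pos).le

theorem rayVolume_eq_log_add_log (h : IsAngleTriple α β γ) (hθ : θ ∈ Set.Ioo 0 α) :
    rayVolume α β γ θ = 1 / 2 * (Real.log (sin (γ + θ)) + Real.log (sin (β + θ)) -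
      Real.log (sin θ) - Real.log (sin (α - θ))) := by
  have hβθ := (h.sin_snd_add_pos hθ).ne'
  have hγθ := (h.swap.sin_snd_add_pos hθ).ne'
  have hθ0 := (h.sin_ray_pos hθ).ne'
  have hαθ := (h.sin_fst_sub_pos hθ).ne'
  rw [rayVolume, Real.log_div (mul_ne_zero hγθ hβθ) (mul_ne_zero hθ0 hαθ),
    Real.log_mul hγθ hβθ, Real.log_mul hθ0 hαθ]
  ring

theorem lintegral_rayVolume (h : IsAngleTriple α β γ) :
    (∫⁻ θ in Set.Ioo 0 α, ENNReal.ofReal (rayVolume α β γ θ)).toReal =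
      logSinIntegral Real.pi - logSinIntegral α - logSinIntegral β - logSinIntegral γ := by
  have hadd (x : ℝ) : IntervalIntegrable (fun θ => Real.log (sin (x + θ))) volume 0 α := by
    simpa using (intervalIntegrable_log_sin_real (x + 0) (x + α)).comp_add_left x
  have hsub : IntervalIntegrable (fun θ => Real.log (sin (α - θ))) volume 0 α := by
    simpa using (intervalIntegrable_log_sin_real (α - 0) (α - α)).comp_sub_left α
  have hint : IntervalIntegrable (fun θ => 1 / 2 * (Real.log (sin (γ + θ)) +
      Real.log (sin (β + θ)) - Real.log (sin θ) - Real.log (sin (α - θ)))) volume 0 α :=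
    ((((hadd γ).add (hadd β)).sub (intervalIntegrable_log_sin_real 0 α)).sub hsub).const_mul (1 / 2)
  have hnonneg : 0 ≤ᵐ[volume.restrict (Set.Ioo 0 α)] rayVolume α β γ := by
    filter_upwards [ae_restrict_mem measurableSet_Ioo] with θ hθ using h.rayVolume_nonneg hθ
  have hmeas : AEStronglyMeasurable (rayVolume α β γ) (volume.restrict (Set.Ioo 0 α)) :=
    ((intervalIntegrable_iff_integrableOn_Ioo_of_le h.fst_pos.le).mp hint).congr_fun
      (fun θ hθ => (h.rayVolume_eq_log_add_log hθ).symm) measurableSet_Ioo |>.aestronglyMeasurable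
  rw [← integral_eq_lintegral_of_nonneg_ae hnonneg hmeas,
    setIntegral_congr_fun measurableSet_Ioo fun θ hθ => h.rayVolume_eq_log_add_log hθ,
    ← integral_Ioc_eq_integral_Ioo, ← intervalIntegral.integral_of_le h.fst_pos.le,
    intervalIntegral.integral_const_mul,
    intervalIntegral.integral_sub
      (((hadd γ).add (hadd β)).sub (intervalIntegrable_log_sin_real _ _)) hsub,
    intervalIntegral.integral_sub ((hadd γ).add (hadd β)) (intervalIntegrable_log_sin_real _ _),
    intervalIntegral.integral_add (hadd γ) (hadd β),
    integral_log_sin_add, integral_log_sin_add, integral_log_sin_sub, ← logSinIntegral,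
    show γ + α = Real.pi - β by linarith [h.add_add_eq_pi],
    show β + α = Real.pi - γ by linarith [h.add_add_eq_pi],
    logSinIntegral_pi_sub, logSinIntegral_pi_sub]
  ring

end IsAngleTriple

theorem im_div_eq_orient (a b c : ℂ) :
    ((c - a) / (b - a)).im = orient a b c / Complex.normSq (b - a) := by
  simp only [Complex.div_im, orient, Complex.sub_re, Complex.sub_im]
  ring

variable {a b c : ℂ}

theorem im_div_pos (h : 0 < orient a b c) : 0 < ((c - a) / (b - a)).im := by
  rw [im_div_eq_orient]
  exact div_pos h (Complex.normSq_pos.mpr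
    (sub_ne_zero.mpr (ne_of_orient_ne_zero h.ne').1.symm))

theorem sin_angleAt (h : a ≠ b) : sin (angleAt a b c) = orient a b c / (‖b - a‖ * ‖c - a‖) := by
  have hn : ‖b - a‖ ≠ 0 := norm_ne_zero_iff.mpr (sub_ne_zero.mpr h.symm)
  rw [angleAt, Complex.sin_arg, im_div_eq_orient, Complex.normSq_eq_norm_sq, norm_div]
  field_simp

theorem angleAt_pos (h : 0 < orient a b c) : 0 < angleAt a b c :=
  (Complex.arg_nonneg_iff.mpr (im_div_pos h).le).lt_of_ne' fun h0 =>
    (im_div_pos h).ne' (Complex.arg_eq_zero_iff.mp h0).2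

open EuclideanGeometry in
theorem angle_eq_angleAt (h : 0 < orient a b c) : ∠ b a c = angleAt a b c := by
  obtain ⟨hab, -, hca⟩ := ne_of_orient_ne_zero h.ne'
  rw [EuclideanGeometry.angle_comm, EuclideanGeometry.angle, vsub_eq_sub, vsub_eq_sub,
    Complex.angle_eq_abs_arg (sub_ne_zero.mpr hca) (sub_ne_zero.mpr hab.symm)]
  exact abs_of_pos (angleAt_pos h)

theorem isAngleTriple_angleAt (h : 0 < orient a b c) :
    IsAngleTriple (angleAt a b c) (angleAt b c a) (angleAt c a b) := by
  have h' : 0 < orient b c a := (orient_rotate a b c).symm ▸ h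
  have h'' : 0 < orient c a b := orient_rotate c a b ▸ h
  refine ⟨angleAt_pos h, angleAt_pos h', angleAt_pos h'', ?_⟩
  rw [← angle_eq_angleAt h, ← angle_eq_angleAt h', ← angle_eq_angleAt h'',
    add_comm (EuclideanGeometry.angle b a c)]
  exact EuclideanGeometry.angle_add_angle_add_angle_eq_pi a (ne_of_orient_ne_zero h.ne').2.1

theorem polarPoint_angleAt (hab : a ≠ b) (c : ℂ) :
    polarPoint a ((b - a) / ‖b - a‖) ‖c - a‖ (angleAt a b c) = c := by
  have hba : b - a ≠ 0 := sub_ne_zero.mpr hab.symm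
  have hpolar := Complex.norm_mul_cos_add_sin_mul_I ((c - a) / (b - a))
  rw [← angleAt, norm_div, eq_div_iff hba] at hpolar
  rw [polarPoint, Complex.polarCoord_symm_apply]
  push_cast at hpolar ⊢
  linear_combination hpolar

theorem norm_sub_eq_mul_sin_angleAt (h : orient a b c ≠ 0) :
    ‖c - a‖ = ‖c - b‖ / sin (angleAt a b c) * sin (angleAt b c a) := by
  obtain ⟨hab, hbc, -⟩ := ne_of_orient_ne_zero h
  have hc : ‖c - b‖ ≠ 0 := norm_ne_zero_iff.mpr (sub_ne_zero.mpr hbc.symm)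
  have hb : ‖b - a‖ ≠ 0 := norm_ne_zero_iff.mpr (sub_ne_zero.mpr hab.symm)
  rw [sin_angleAt hab, sin_angleAt hbc, orient_rotate a b c, norm_sub_rev a b]
  field_simp

theorem idealVolume_eq_logSinIntegral (h : 0 < orient a b c) :
    idealVolume {a, b, c} = logSinIntegral Real.pi - logSinIntegral (angleAt a b c) -
      logSinIntegral (angleAt b c a) - logSinIntegral (angleAt c a b) := by
  obtain ⟨hab, hbc, -⟩ := ne_of_orient_ne_zero h.ne'
  have h'' : 0 < orient c a b := orient_rotate c a b ▸ h
  have hT := isAngleTriple_angleAt h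
  have hba : b - a ≠ 0 := sub_ne_zero.mpr hab.symm
  have hD : 0 < ‖c - b‖ / sin (angleAt a b c) :=
    div_pos (norm_pos_iff.mpr (sub_ne_zero.mpr hbc.symm)) hT.sin_fst_pos
  have hu : ‖(b - a) / (‖b - a‖ : ℂ)‖ = 1 := by
    rw [norm_div, Complex.norm_real, norm_norm, div_self (norm_ne_zero_iff.mpr hba)]
  have hb : polarPoint a ((b - a) / ‖b - a‖)
      (‖c - b‖ / sin (angleAt a b c) * sin (angleAt c a b)) 0 = b := by
    have hγ := norm_sub_eq_mul_sin_angleAt h''.ne'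
    have hpolar := polarPoint_angleAt hab b
    rw [angleAt, div_self hba, Complex.arg_one] at hpolar
    rw [norm_sub_rev c b, hγ, mul_div_cancel_right₀ _ hT.sin_fst_pos.ne',
      div_mul_cancel₀ _ hT.swap.sin_snd_pos.ne', hpolar]
  have hc : polarPoint a ((b - a) / ‖b - a‖)
      (‖c - b‖ / sin (angleAt a b c) * sin (angleAt b c a)) (angleAt a b c) = c := by
    rw [← norm_sub_eq_mul_sin_angleAt h.ne', polarPoint_angleAt hab]
  have hvol := lintegral_fibreVolume hu hD hT (a := a)
  rw [hb, hc] at hvol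
  rw [idealVolume_eq_toReal_lintegral h, hvol, hT.lintegral_rayVolume]

end AngleFormula

section Curves

open Real (sin cos)

theorem hasDerivAt_logSinIntegral {x : ℝ} (hx : sin x ≠ 0) :
    HasDerivAt logSinIntegral (Real.log (sin x)) x :=
  intervalIntegral.integral_hasDerivAt_right (intervalIntegrable_log_sin_real 0 x)
    (Real.measurable_log.comp Real.measurable_sin).stronglyMeasurable.stronglyMeasurableAtFilter
    (Real.continuous_sin.continuousAt.log hx)

theorem log_sin_angleAt {a b c : ℂ} (h : 0 < orient a b c) :
    Real.log (sin (angleAt a b c)) =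
      Real.log (orient a b c) - Real.log ‖b - a‖ - Real.log ‖a - c‖ := by
  obtain ⟨hab, -, hca⟩ := ne_of_orient_ne_zero h.ne'
  have hba : ‖b - a‖ ≠ 0 := norm_ne_zero_iff.mpr (sub_ne_zero.mpr hab.symm)
  have hac : ‖a - c‖ ≠ 0 := norm_ne_zero_iff.mpr (sub_ne_zero.mpr hca.symm)
  rw [sin_angleAt hab, norm_sub_rev c a, Real.log_div h.ne' (mul_ne_zero hba hac),
    Real.log_mul hba hac, sub_sub]

theorem continuous_orient : Continuous fun x : ℂ × ℂ × ℂ => orient x.1 x.2.1 x.2.2 := by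
  unfold orient
  fun_prop

variable {p q r : ℝ → ℂ} {p' q' r' : ℂ} {t : ℝ}

theorem hasDerivAt_angleAt (hp : HasDerivAt p p' t) (hq : HasDerivAt q q' t)
    (hr : HasDerivAt r r' t) (h : 0 < orient (p t) (q t) (r t)) :
    HasDerivAt (fun t => angleAt (p t) (q t) (r t))
      (((p' - r') / (p t - r t)).im - ((q' - p') / (q t - p t)).im) t := by
  obtain ⟨hpq, -, hrp⟩ := ne_of_orient_ne_zero h.ne'
  have hqp : q t - p t ≠ 0 := sub_ne_zero.mpr hpq.symm
  have hpr : r t - p t ≠ 0 := sub_ne_zero.mpr hrp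
  have hlog := ((hr.fun_sub hp).fun_div (hq.fun_sub hp) hqp).clog_real
    (Or.inr (im_div_pos h).ne')
  have him := Complex.imCLM.hasFDerivAt.comp_hasDerivAt t hlog
  simp only [Function.comp_def, Complex.imCLM_apply, Complex.log_im] at him
  refine him.congr_deriv ?_
  rw [← Complex.sub_im, ← neg_sub r', ← neg_sub (r t), neg_div_neg_eq]
  congr 1
  field_simp

theorem hasDerivAt_log_norm {f : ℝ → ℂ} {f' : ℂ} (hf : HasDerivAt f f' t) (h : f t ≠ 0) :
    HasDerivAt (fun s => Real.log ‖f s‖) (f' / f t).re t := by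
  have hlog := (hf.norm_sq.log (by positivity)).const_mul (1 / 2)
  simp only [Real.log_pow] at hlog
  refine (hlog.congr_deriv ?_).congr_of_eventuallyEq (.of_forall fun s => ?_)
  · rw [Complex.inner, Complex.div_re, Complex.mul_re, Complex.sq_norm]
    simp only [Complex.conj_re, Complex.conj_im]
    ring
  · push_cast
    ring

theorem hasDerivAt_idealVolume (hp : HasDerivAt p p' t) (hq : HasDerivAt q q' t)
    (hr : HasDerivAt r r' t) (h : 0 < orient (p t) (q t) (r t)) :
    HasDerivAt (fun t => idealVolume {p t, q t, r t})
      (((q' - p') / (q t - p t)).im * (Real.log ‖r t - q t‖ - Real.log ‖p t - r t‖) +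
        ((r' - q') / (r t - q t)).im * (Real.log ‖p t - r t‖ - Real.log ‖q t - p t‖) +
        ((p' - r') / (p t - r t)).im * (Real.log ‖q t - p t‖ - Real.log ‖r t - q t‖)) t := by
  have h' : 0 < orient (q t) (r t) (p t) := (orient_rotate _ _ _).symm ▸ h
  have h'' : 0 < orient (r t) (p t) (q t) := orient_rotate (r t) _ _ ▸ h
  have hT := isAngleTriple_angleAt h
  have hα := (hasDerivAt_logSinIntegral hT.sin_fst_pos.ne').comp t (hasDerivAt_angleAt hp hq hr h)
  have hβ := (hasDerivAt_logSinIntegral hT.sin_snd_pos.ne').comp t (hasDerivAt_angleAt hq hr hp h')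
  have hγ := (hasDerivAt_logSinIntegral hT.swap.sin_snd_pos.ne').comp t
    (hasDerivAt_angleAt hr hp hq h'')
  have horient : ∀ᶠ s in nhds t, 0 < orient (p s) (q s) (r s) :=
    (continuous_orient.continuousAt.comp (hp.continuousAt.prodMk
      (hq.continuousAt.prodMk hr.continuousAt))).eventually (lt_mem_nhds h)
  have hvolume := ((hα.const_sub (logSinIntegral Real.pi)).sub hβ).sub hγ
  refine (hvolume.congr_deriv ?_).congr_of_eventuallyEq
    (horient.mono fun s hs => idealVolume_eq_logSinIntegral hs)
  rw [log_sin_angleAt h, log_sin_angleAt h', log_sin_angleAt h'', orient_rotate (p t),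
    ← orient_rotate (r t)]
  ring

end Curves

section Wirtinger

open scoped ComplexConjugate

variable {ι : Type*}

theorem hasDerivAt_add_smul_apply (x e : ι → ℂ) (j : ι) :
    HasDerivAt (fun t : ℝ => (x + t • e) j) (e j) 0 := by
  simpa using ((hasDerivAt_id (0 : ℝ)).smul_const (e j)).const_add (x j)

variable [DecidableEq ι]

/-- `∂g/∂z_u = a` and `∂g/∂z̄_u = b` at `x`. Asking for the line derivative `a e + b ē` in every
complex direction `e` of the `u`-th coordinate makes the differentiation rules those of
`HasDerivAt`, whereas `wirtinger` and `wirtingerBar` take junk values at non-differentiable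
functions. -/
def HasWirtingerDerivAt (u : ι) (g : (ι → ℂ) → ℂ) (a b : ℂ) (x : ι → ℂ) : Prop :=
  ∀ e : ℂ, HasLineDerivAt ℝ g (a * e + b * conj e) x (Pi.single u e)

namespace HasWirtingerDerivAt

variable {u : ι} {f g : (ι → ℂ) → ℂ} {a b a' b' : ℂ} {x : ι → ℂ}

theorem wirtinger_eq (h : HasWirtingerDerivAt u g a b x) : wirtinger u g x = a := by
  rw [wirtinger, (h 1).lineDeriv, (h Complex.I).lineDeriv, map_one, Complex.conj_I]
  linear_combination (-a / 2 + b / 2) * Complex.I_sq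

theorem wirtingerBar_eq (h : HasWirtingerDerivAt u g a b x) : wirtingerBar u g x = b := by
  rw [wirtingerBar, (h 1).lineDeriv, (h Complex.I).lineDeriv, map_one, Complex.conj_I]
  linear_combination (a / 2 - b / 2) * Complex.I_sq

theorem congr_deriv (h : HasWirtingerDerivAt u g a b x) (ha : a = a') (hb : b = b') :
    HasWirtingerDerivAt u g a' b' x :=
  ha ▸ hb ▸ h

theorem congr_of_eventuallyEq [Finite ι] (h : HasWirtingerDerivAt u g a b x)
    (hfg : f =ᶠ[nhds x] g) : HasWirtingerDerivAt u f a b x := by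
  cases nonempty_fintype ι
  exact fun e => (h e).congr_of_eventuallyEq hfg

theorem add (hf : HasWirtingerDerivAt u f a b x) (hg : HasWirtingerDerivAt u g a' b' x) :
    HasWirtingerDerivAt u (fun y => f y + g y) (a + a') (b + b') x := fun e =>
  ((hf e).fun_add (hg e)).congr_deriv (by ring)

theorem sub (hf : HasWirtingerDerivAt u f a b x) (hg : HasWirtingerDerivAt u g a' b' x) :
    HasWirtingerDerivAt u (fun y => f y - g y) (a - a') (b - b') x := fun e =>
  ((hf e).fun_sub (hg e)).congr_deriv (by ring)

theorem mul (hf : HasWirtingerDerivAt u f a b x) (hg : HasWirtingerDerivAt u g a' b' x) :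
    HasWirtingerDerivAt u (fun y => f y * g y) (a * g x + f x * a') (b * g x + f x * b') x :=
  fun e => ((hf e).fun_mul (hg e)).congr_deriv (by simp only [zero_smul, add_zero]; ring)

theorem const_mul (c : ℂ) (h : c ≠ 0 → HasWirtingerDerivAt u g a b x) :
    HasWirtingerDerivAt u (fun y => c * g y) (c * a) (c * b) x := by
  intro e
  obtain rfl | hc := eq_or_ne c 0
  · simp only [zero_mul, add_zero]
    exact hasDerivAt_const (0 : ℝ) (0 : ℂ)
  · exact (HasDerivAt.const_mul c (h hc e)).congr_deriv (by ring)

theorem sum {κ : Type*} {s : Finset κ} {g : κ → (ι → ℂ) → ℂ} {a b : κ → ℂ}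
    (h : ∀ k ∈ s, HasWirtingerDerivAt u (g k) (a k) (b k) x) :
    HasWirtingerDerivAt u (fun y => ∑ k ∈ s, g k y) (∑ k ∈ s, a k) (∑ k ∈ s, b k) x := fun e =>
  (HasDerivAt.fun_sum fun k hk => h k hk e).congr_deriv <| by
    rw [Finset.sum_add_distrib, Finset.sum_mul, Finset.sum_mul]

end HasWirtingerDerivAt

/-- The difference quotient between `x p` and `x q` of the variation moving only the `u`-th point,
with velocity `1`. -/
noncomputable def coordSlope (u p q : ι) (x : ι → ℂ) : ℂ :=
  ((Pi.single u 1 : ι → ℂ) q - (Pi.single u 1 : ι → ℂ) p) / (x q - x p)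

theorem single_sub_single_div (u p q : ι) (e : ℂ) (x : ι → ℂ) :
    ((Pi.single u e : ι → ℂ) q - (Pi.single u e : ι → ℂ) p) / (x q - x p) =
      coordSlope u p q x * e := by
  simp only [coordSlope, Pi.single_apply]
  split_ifs <;> ring

theorem hasWirtingerDerivAt_log_norm_sub (u : ι) {p q : ι} {x : ι → ℂ} (h : x p ≠ x q) :
    HasWirtingerDerivAt u (fun y => (Real.log ‖y q - y p‖ : ℂ))
      (coordSlope u p q x / 2) (conj (coordSlope u p q x) / 2) x := by
  intro e
  have hlog := (hasDerivAt_log_norm ((hasDerivAt_add_smul_apply x (Pi.single u e) q).fun_sub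
    (hasDerivAt_add_smul_apply x (Pi.single u e) p))
    (by simpa [sub_eq_zero] using h.symm)).ofReal_comp
  refine hlog.congr_deriv ?_
  simp only [zero_smul, add_zero, single_sub_single_div, Complex.re_eq_add_conj, map_mul]
  ring

theorem hasWirtingerDerivAt_conj_coordSlope (u v : ι) {p q : ι} {x : ι → ℂ} (h : x p ≠ x q) :
    HasWirtingerDerivAt u (fun y => conj (coordSlope v p q y))
      0 (-conj (coordSlope v p q x * coordSlope u p q x)) x := by
  intro e
  have hqp : x q - x p ≠ 0 := sub_ne_zero.mpr h.symm
  have hsub := (hasDerivAt_add_smul_apply x (Pi.single u e) q).fun_sub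
    (hasDerivAt_add_smul_apply x (Pi.single u e) p)
  have hinv := ((hsub.fun_inv (by simpa using hqp)).const_mul
    ((Pi.single v 1 : ι → ℂ) q - (Pi.single v 1 : ι → ℂ) p)).star
  refine hinv.congr_deriv ?_
  have hslope := single_sub_single_div u p q e x
  simp only [zero_smul, add_zero, zero_mul, zero_add, ← map_mul, ← map_neg, RCLike.star_def]
  rw [neg_mul, mul_assoc, ← hslope, coordSlope]
  congr 1
  field_simp

/-- The value of `∂/∂z̄_v` on the volume of the ideal tetrahedron over the triangle `x p`, `x q`,
`x r`, see `hasWirtingerDerivAt_idealVolume`. -/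
noncomputable def volumeWirtingerBar (v p q r : ι) (x : ι → ℂ) : ℂ :=
  Complex.I / 2 *
    (conj (coordSlope v p q x) * (Real.log ‖x r - x q‖ - Real.log ‖x p - x r‖) +
      conj (coordSlope v q r x) * (Real.log ‖x p - x r‖ - Real.log ‖x q - x p‖) +
      conj (coordSlope v r p x) * (Real.log ‖x q - x p‖ - Real.log ‖x r - x q‖))

theorem hasWirtingerDerivAt_idealVolume (v : ι) {p q r : ι} {x : ι → ℂ}
    (h : 0 < orient (x p) (x q) (x r)) :
    HasWirtingerDerivAt v (fun y => (idealVolume {y p, y q, y r} : ℂ))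
      (conj (volumeWirtingerBar v p q r x)) (volumeWirtingerBar v p q r x) x := by
  intro e
  have hline := hasDerivAt_add_smul_apply x (Pi.single v e)
  have hvolume := (hasDerivAt_idealVolume (hline p) (hline q) (hline r)
    (by simpa using h)).ofReal_comp
  refine hvolume.congr_deriv ?_
  simp only [zero_smul, add_zero, single_sub_single_div, volumeWirtingerBar, Complex.ofReal_add,
    Complex.ofReal_mul, Complex.ofReal_sub, Complex.im_eq_sub_conj, map_mul, map_add, map_sub,
    map_div₀, Complex.conj_I, Complex.conj_conj, Complex.conj_ofReal, map_ofNat]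
  field_simp
  rw [Complex.I_sq]
  ring

/-- The second divided difference at `x a`, `x b`, `x c` of the variation moving only the `u`-th
point, with velocity `1`. -/
noncomputable def coordDivDiff (u a b c : ι) (x : ι → ℂ) : ℂ :=
  secondDivDiff (x a) (x b) (x c) ((Pi.single u 1 : ι → ℂ) a) ((Pi.single u 1 : ι → ℂ) b)
    ((Pi.single u 1 : ι → ℂ) c)

theorem coordSlope_sub_coordSlope (u : ι) {p q r : ι} {x : ι → ℂ} (hpq : x p ≠ x q)
    (hqr : x q ≠ x r) (hrp : x r ≠ x p) :
    coordSlope u q r x - coordSlope u r p x = (x q - x p) * coordDivDiff u p q r x := by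
  have hpq' : x p - x q ≠ 0 := sub_ne_zero.mpr hpq
  have hqr' : x q - x r ≠ 0 := sub_ne_zero.mpr hqr
  have hrp' : x r - x p ≠ 0 := sub_ne_zero.mpr hrp
  rw [coordSlope, coordSlope, coordDivDiff, secondDivDiff, ← neg_sub (x p) (x q),
    ← neg_sub (x q) (x r), ← neg_sub (x r) (x p)]
  field_simp
  ring

theorem coordDivDiff_rotate (u a b c : ι) (x : ι → ℂ) :
    coordDivDiff u b c a x = coordDivDiff u a b c x :=
  secondDivDiff_rotate ..

theorem two_mul_I_mul_orient (a b c : ℂ) :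
    2 * Complex.I * (orient a b c : ℂ) = conj (b - a) * (c - b) - (b - a) * conj (c - b) := by
  apply Complex.ext <;> simp [orient] <;> ring

theorem sum_conj_coordSlope_mul_sub (u v : ι) {p q r : ι} {x : ι → ℂ} (hpq : x p ≠ x q)
    (hqr : x q ≠ x r) (hrp : x r ≠ x p) :
    conj (coordSlope v p q x) * (coordSlope u q r x - coordSlope u r p x) +
        conj (coordSlope v q r x) * (coordSlope u r p x - coordSlope u p q x) +
        conj (coordSlope v r p x) * (coordSlope u p q x - coordSlope u q r x) =
      2 * Complex.I * orient (x p) (x q) (x r) *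
        (coordDivDiff u p q r x * conj (coordDivDiff v p q r x)) := by
  have hqrp (w : ι) := coordDivDiff_rotate w p q r x
  have hrpq (w : ι) := coordDivDiff_rotate w q r p x
  have hpq_conj := congrArg conj (coordSlope_sub_coordSlope v hpq hqr hrp)
  have hqr_conj := congrArg conj (coordSlope_sub_coordSlope v hqr hrp hpq)
  simp only [hqrp, map_sub, map_mul] at hpq_conj hqr_conj
  rw [coordSlope_sub_coordSlope u hpq hqr hrp, coordSlope_sub_coordSlope u hqr hrp hpq,
    coordSlope_sub_coordSlope u hrp hpq hqr, hrpq, hqrp, two_mul_I_mul_orient, map_sub, map_sub]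
  linear_combination coordDivDiff u p q r x *
    ((x r - x q) * hpq_conj - (x q - x p) * hqr_conj)

theorem hasWirtingerDerivAt_volumeWirtingerBar (u v : ι) {p q r : ι} {x : ι → ℂ}
    (h : 0 < orient (x p) (x q) (x r)) :
    ∃ b, HasWirtingerDerivAt u (volumeWirtingerBar v p q r)
      (-(orient (x p) (x q) (x r) / 2 * (coordDivDiff u p q r x * conj (coordDivDiff v p q r x))))
      b x := by
  obtain ⟨hpq, hqr, hrp⟩ := ne_of_orient_ne_zero h.ne'
  have hlog {a b : ι} (hab : x a ≠ x b) := hasWirtingerDerivAt_log_norm_sub u hab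
  have hconj {a b : ι} (hab : x a ≠ x b) := hasWirtingerDerivAt_conj_coordSlope u v hab
  have hsum := (((hconj hpq).mul ((hlog hqr).sub (hlog hrp))).add
    ((hconj hqr).mul ((hlog hrp).sub (hlog hpq)))).add
    ((hconj hrp).mul ((hlog hpq).sub (hlog hqr)))
  refine ⟨_, (HasWirtingerDerivAt.const_mul (Complex.I / 2) fun _ => hsum).congr_deriv ?_ rfl⟩
  linear_combination (Complex.I / 4) * sum_conj_coordSlope_mul_sub u v hpq hqr hrp +
    (orient (x p) (x q) (x r) / 2 * (coordDivDiff u p q r x * conj (coordDivDiff v p q r x)) : ℂ) *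
      Complex.I_sq

end Wirtinger

section KahlerMatrix

open scoped ComplexConjugate

variable {ι : Type*} [DecidableEq ι] {z : ι → ℂ}

/-- The contribution of the triangle `a b c` to the Kähler matrix: the matrix of the Hermitian form
`faceForm z · a b c`. -/
noncomputable def faceMatrix (z : ι → ℂ) (a b c : ι) : Matrix ι ι ℂ :=
  (orient (z a) (z b) (z c) / 2) • Matrix.vecMulVec (fun u => coordDivDiff u a b c z)
    (star fun v => coordDivDiff v a b c z)

theorem posSemidef_faceMatrix [Finite ι] {a b c : ι} (h : 0 ≤ orient (z a) (z b) (z c)) :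
    (faceMatrix z a b c).PosSemidef :=
  (Matrix.posSemidef_vecMulVec_self_star _).smul (div_nonneg h zero_le_two)

theorem sum_mul_coordDivDiff [Fintype ι] (φ : ι → ℂ) (a b c : ι) (x : ι → ℂ) :
    ∑ u, φ u * coordDivDiff u a b c x = secondDivDiff (x a) (x b) (x c) (φ a) (φ b) (φ c) := by
  simp only [coordDivDiff, secondDivDiff, mul_add, Finset.sum_add_distrib, ← mul_div_assoc,
    ← Finset.sum_div, Pi.single_apply, mul_ite, mul_one, mul_zero, Finset.sum_ite_eq,
    Finset.mem_univ, if_true]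

theorem star_dotProduct_faceMatrix_mulVec [Fintype ι] (x : ι → ℂ) (a b c : ι) :
    star x ⬝ᵥ (faceMatrix z a b c).mulVec x = faceForm z (star x) a b c := by
  have hdot : star x ⬝ᵥ (fun u => coordDivDiff u a b c z) = _ :=
    sum_mul_coordDivDiff (star x) a b c z
  rw [faceMatrix, Matrix.smul_mulVec, Matrix.vecMulVec_mulVec, dotProduct_smul, op_smul_eq_smul,
    dotProduct_smul, Matrix.star_dotProduct, hdot, faceForm, Complex.ofReal_mul,
    Complex.normSq_eq_conj_mul_self, smul_eq_mul, Complex.real_smul, RCLike.star_def]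

namespace PointTriangulation

variable (T : PointTriangulation z)

theorem prepotential_eq_sum_faceChain [Fintype ι] (x : ι → ℂ) :
    (prepotential T.faces x : ℂ) =
      -(1 / 3) * ∑ a, ∑ b, ∑ c, (T.faceChain a b c : ℂ) * idealVolume {x a, x b, x c} := by
  have hsum := T.sum_faceChain_mul fun f => idealVolume (x '' (f : Set ι))
  simp only [Finset.coe_insert, Finset.coe_singleton, Set.image_insert_eq,
    Set.image_singleton] at hsum
  have hcast := congrArg (fun s : ℝ => (s : ℂ)) hsum
  push_cast at hcast
  rw [hcast, prepotential]
  push_cast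
  ring

theorem eventually_orient_pos :
    ∀ᶠ x in nhds z, ∀ a b c, T.faceChain a b c ≠ 0 → 0 < orient (x a) (x b) (x c) := by
  have := T.finite
  simp only [Filter.eventually_all]
  intro a b c h
  have hcont : Continuous fun x : ι → ℂ => orient (x a) (x b) (x c) :=
    continuous_orient.comp (f := fun x : ι → ℂ => (x a, x b, x c)) (by fun_prop)
  exact hcont.continuousAt.eventually (lt_mem_nhds (faceChain_ne_zero.mp h).2)

theorem wirtingerBar_prepotential_eventuallyEq [Fintype ι] (v : ι) :
    wirtingerBar v (fun x => (prepotential T.faces x : ℂ)) =ᶠ[nhds z] fun x =>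
      -(1 / 3) * ∑ a, ∑ b, ∑ c, (T.faceChain a b c : ℂ) * volumeWirtingerBar v a b c x := by
  filter_upwards [T.eventually_orient_pos] with x hx
  simp only [T.prepotential_eq_sum_faceChain]
  exact (HasWirtingerDerivAt.const_mul _ fun _ => .sum fun a _ => .sum fun b _ => .sum fun c _ =>
    .const_mul _ fun h => hasWirtingerDerivAt_idealVolume v
      (hx a b c (by exact_mod_cast h))).wirtingerBar_eq

theorem kahlerMatrix_eq_sum_faceMatrix [Fintype ι] :
    kahlerMatrix T =
      (1 / 3 : ℝ) • ∑ a, ∑ b, ∑ c, (T.faceChain a b c : ℝ) • faceMatrix z a b c := by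
  ext u v
  have hvolume (a b c : ι) (h : T.faceChain a b c ≠ 0) :=
    hasWirtingerDerivAt_volumeWirtingerBar u v (faceChain_ne_zero.mp h).2
  choose! d hd using hvolume
  have hsum := (HasWirtingerDerivAt.const_mul (-(1 / 3)) fun _ => .sum fun a _ => .sum fun b _ =>
    .sum fun c _ => .const_mul (T.faceChain a b c : ℂ) fun h => hd a b c (by exact_mod_cast h))
    |>.congr_of_eventuallyEq (T.wirtingerBar_prepotential_eventuallyEq v)
  rw [kahlerMatrix, Matrix.of_apply, hsum.wirtinger_eq]
  simp only [mul_neg, Finset.sum_neg_distrib, neg_mul, neg_neg, faceMatrix, Matrix.smul_apply,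
    Matrix.sum_apply, Matrix.vecMulVec_apply, Complex.real_smul, Pi.star_apply, RCLike.star_def]
  push_cast
  rfl

theorem posSemidef_kahlerMatrix : (kahlerMatrix T).PosSemidef := by
  have := T.finite
  cases nonempty_fintype ι
  rw [kahlerMatrix_eq_sum_faceMatrix]
  refine .smul (Matrix.posSemidef_sum _ fun a _ => Matrix.posSemidef_sum _ fun b _ =>
    Matrix.posSemidef_sum _ fun c _ => ?_) (by norm_num : (0 : ℝ) ≤ 1 / 3)
  by_cases h : T.faceChain a b c = 0
  · rw [h, Int.cast_zero, zero_smul]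
    exact .zero
  · exact (posSemidef_faceMatrix (faceChain_ne_zero.mp h).2.le).smul
      (by exact_mod_cast (T.isFilling_faceChain T).nonneg a b c : (0 : ℝ) ≤ T.faceChain a b c)

theorem star_dotProduct_kahlerMatrix_mulVec [Fintype ι] (x : ι → ℂ) :
    star x ⬝ᵥ (kahlerMatrix T).mulVec x =
      (1 / 3 * ∑ a, ∑ b, ∑ c, (T.faceChain a b c : ℝ) * faceForm z (star x) a b c : ℝ) := by
  simp only [kahlerMatrix_eq_sum_faceMatrix, Matrix.smul_mulVec, Matrix.sum_mulVec,
    dotProduct_smul, dotProduct_sum, star_dotProduct_faceMatrix_mulVec, Complex.real_smul]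
  push_cast
  rfl

theorem IsDelaunay.posSemidef_kahlerMatrix_sub {TD : PointTriangulation z} (hTD : TD.IsDelaunay)
    (T : PointTriangulation z) : (kahlerMatrix TD - kahlerMatrix T).PosSemidef := by
  have := T.finite
  cases nonempty_fintype ι
  refine .of_dotProduct_mulVec_nonneg
    (TD.posSemidef_kahlerMatrix.isHermitian.sub T.posSemidef_kahlerMatrix.isHermitian) fun x => ?_
  have hle := IsFilling.sum_faceForm_le (star x) (T.isFilling_faceChain TD)
    (TD.isFilling_faceChain TD) TD.injective (fun a b h => TD.orient_nonneg_of_boundary_pos h)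
    (fun a b c h => hTD.circumpower_nonneg h)
  rw [Matrix.sub_mulVec, dotProduct_sub, star_dotProduct_kahlerMatrix_mulVec,
    star_dotProduct_kahlerMatrix_mulVec, sub_nonneg, Complex.real_le_real]
  gcongr

end PointTriangulation

end KahlerMatrix

theorem mainTheorem2_general {ι κ : Type*} [DecidableEq ι] [Fintype κ] [DecidableEq κ]
    {z : ι → ℂ} (e : κ → ι) (TD : PointTriangulation z) (hTD : TD.IsDelaunay) :
    IsGreatest (Set.range fun T : PointTriangulation z => ((kahlerMatrix T).submatrix e e).det)
      ((kahlerMatrix TD).submatrix e e).det := by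
  refine ⟨⟨TD, rfl⟩, ?_⟩
  rintro _ ⟨T, rfl⟩
  exact det_le_det_of_posSemidef (T.posSemidef_kahlerMatrix.submatrix e)
    ((hTD.posSemidef_kahlerMatrix_sub T).submatrix e)

theorem mainTheorem2 (N : ℕ) (z : Fin (N + 3) → ℂ) (hz : Function.Injective z)
    (i j k : Fin (N + 3)) (hij : i ≠ j) (hik : i ≠ k) (hjk : j ≠ k)
    (TD : PointTriangulation z) (hTD : TD.IsDelaunay) :
    IsGreatest (Set.range fun T : PointTriangulation z => kahlerMinor i j k T)
      (kahlerMinor i j k TD) :=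
  mainTheorem2_general _ TD hTD
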